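/- Let $M$ be a compact smooth surface with smooth boundary $\partial M$, and let $u\colon M\to\mathbb{R}^n$ be a branched immersion that is injective on $\partial M$. That is, $u$ is $C^1$ up to the boundary, and for every $p\in M$ either $u$ is an immersion near $p$, or there are an integer $m\ge 2$, a local $C^1$ coordinate $z$ on $M$ with values in $\mathbb{C}$ and $z(p)=0$, and a map $f$ such that, after a rigid motion of $\mathbb{R}^n\simeq\mathbb{C}\times\mathbb{R}^{n-2}$, $u=(z^m,f(z))$ near $p$. Put $\Gamma=u(\partial M)$. Let $dA=Ju\,d\mathcal{H}^2$ with $Ju=\sqrt{\det(du^*\circ du)}$ be the area measure of $u$ on $M$, and write $\int_{M\cap B}\cdot\,dA$ for the integral over $u^{-1}(B)$ and $\operatorname{area}(M\cap B)=\int_{M\cap B}dA$, so that area is counted with multiplicity. For $T\subset[0,\infty)$, the area of a cone piece $\{x_0+t(x-x_0):x\in\Gamma,\ t\in T\}$ is likewise counted with multiplicity, i.e. it is the integral of the Jacobian of $(x,t)\mapsto x_0+t(x-x_0)$ on $\Gamma\times T$. Balls $B_r(x)$ are open. Suppose that $M$ has mean curvature vector $H$: $H\colon M\to\mathbb{R}^n$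 is an integrable normal vector field with $\int_M\operatorname{div}_MX\,dA=\int_MX\cdot H\,dA$ for all $C^1$ vector fields $X$ with compact support in $\mathbb{R}^n\setminus\Gamma$. Suppose moreover that the divergence identity with boundary term holds: $$\int_M\operatorname{div}_MX\,dA=\int_MX\cdot H\,dA+\int_\Gamma X\cdot\nu_M\,d\mathcal{H}^1\qquad\text{for every }C^1\text{ vector field }X\text{ on }\mathbb{R}^n,$$ where $\nu_M$ is the outward unit normal to $\Gamma$ tangent to $M$. Let $x_0\in\mathbb{R}^n$, let $E=\{x_0+t(x-x_0):x\in\Gamma,\ t\ge1\}$ be the exterior cone, and put $$m(r)=\frac{\operatorname{area}(M\cap B_r(x_0))+\operatorname{area}(E\cap B_r(x_0))}{r^2}.$$ Suppose that property (P) holds with constants $\alpha\in(0,1]$ and $\Lambda\ge0$: $$\int_{M\cap B_r(x_0)}|H|\,dA\le\alpha\Lambda r^{\alpha+1}m(r)\qquad\text{for all }r>0.$$ Let $r_0=\max_{x,y\in u(M)}|x-y|$ be the extrinsic diameter of $M$ (with $r_0=0$ if $M=\emptyset$), and let $C_{x_0}\Gamma=\{x_0+t(x-x_0):x\in\Gamma,\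 0\le t\le1\}$. Densities are $\Theta(S,x_0)=\lim_{r\to0}\operatorname{area}(S\cap B_r(x_0))/(\pi r^2)$. Then $\Theta(C_{x_0}\Gamma,x_0)$ exists in $[0,\infty]$, and $$\Theta(C_{x_0}\Gamma,x_0)\ \ge\ e^{-\Lambda r_0^\alpha}\Bigl(1-\frac{\alpha\Lambda r_0^\alpha}{2}\Bigr)\,\Theta(M,x_0).$$ Here, if $\Theta(C_{x_0}\Gamma,x_0)<\infty$, the limit $\Theta(M,x_0)$ exists and is finite; in any case the inequality holds with the upper density ($\limsup$ in place of $\lim$) of $M$ at $x_0$, its right side being read as $0$ when $1-\alpha\Lambda r_0^\alpha/2\le0$. -/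

import Mathlib

open Set Filter Topology MeasureTheory
open scoped ENNReal Manifold ContDiff

noncomputable section

namespace BranchedSurface

/-- `ℝᵏ` with its Euclidean norm. -/
abbrev E (k : ℕ) : Type := EuclideanSpace ℝ (Fin k)

variable {n : ℕ}
variable {M : Type*} [TopologicalSpace M] [ChartedSpace (EuclideanHalfSpace 2) M]

/-- The differential `du_p : T_pM → ℝⁿ`, where `T_pM` is identified with `ℝ²` by the preferred chart
at `p`. When `p` is a boundary point, `v ∈ T_pM` is tangent to `∂M` iff `v 0 = 0`, and it points
into `M` iff `0 < v 0`. -/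
def du (u : M → E n) (p : M) : E 2 →L[ℝ] E n := mfderiv (𝓡∂ 2) 𝓘(ℝ, E n) u p

/-- Case (i): `u` is an immersion in a neighbourhood of `p`. -/
def IsImmersedNear (u : M → E n) (p : M) : Prop :=
  ∀ᶠ q in 𝓝 p, Function.Injective (du u q)

/-- Case (ii): `u` has a branch point at `p`. There are `m ≥ 2`, a local `C¹` coordinate
`z : M → ℂ` centred at `p` and a rigid motion of `ℝⁿ`, identified with `ℂ × ℝⁿ⁻²`, such that
`u = (z ^ m, f(z))` near `p`. -/
def IsBranchPoint (u : M → E n) (p : M) : Prop :=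
  ∃ (m : ℕ) (z : M → ℂ) (R : WithLp 2 (ℂ × E (n - 2)) ≃ₗᵢ[ℝ] E n) (a : E n) (f : ℂ → E (n - 2)),
    2 ≤ m ∧ z p = 0 ∧ ContMDiffAt (𝓡∂ 2) 𝓘(ℝ, ℂ) 1 z p ∧
    Function.Bijective (mfderiv (𝓡∂ 2) 𝓘(ℝ, ℂ) z p) ∧
    ∀ᶠ q in 𝓝 p, u q = a + R (WithLp.toLp 2 (z q ^ m, f (z q)))

/-- A branched immersion: a `C¹` map (up to the boundary) that near every point is an immersion or
has a branch point there. -/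
def IsBranchedImmersion (u : M → E n) : Prop :=
  ContMDiff (𝓡∂ 2) 𝓘(ℝ, E n) 1 u ∧ ∀ p : M, IsImmersedNear u p ∨ IsBranchPoint u p

/-- The Jacobian `√(det (L* ∘ L))` of a linear map `L : ℝ² → ℝⁿ`. -/
def jacobian (L : E 2 →L[ℝ] E n) : ℝ :=
  √(LinearMap.det ((ContinuousLinearMap.adjoint L ∘L L : E 2 →L[ℝ] E 2) : E 2 →ₗ[ℝ] E 2))

/-- The part of the area measure of `u` in the domain of the preferred chart `φ` at `p`: the
image under `φ⁻¹` of Lebesgue measure on the range of `φ` times the Jacobian of `u ∘ φ⁻¹`. -/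
def chartArea [MeasurableSpace M] (u : M → E n) (p : M) : Measure M :=
  ((volume.restrict (extChartAt (𝓡∂ 2) p).target).withDensity fun y =>
    ENNReal.ofReal (jacobian
      (fderivWithin ℝ (u ∘ (extChartAt (𝓡∂ 2) p).symm) (range (𝓡∂ 2)) y))).map
    (extChartAt (𝓡∂ 2) p).symm

/-- The area measure `dA = Ju dℋ²` of `u` on `M`. The measures `chartArea u p` agree on the overlaps
of the charts, so their supremum is the measure that coincides with each of them on the
domain of its chart. -/
def areaMeasure [MeasurableSpace M] (u : M → E n) : Measure M := ⨆ p : M, chartArea u p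

/-- The area, with multiplicity, of `M ∩ B_r(x)`, i.e. the integral of `Ju` over `u⁻¹(B_r(x))`. -/
def surfaceArea [MeasurableSpace M] (u : M → E n) (x : E n) (r : ℝ) : ℝ≥0∞ :=
  areaMeasure u (u ⁻¹' Metric.ball x r)

/-- The extrinsic diameter `r₀` of the image of `M`. -/
def extrinsicDiam (u : M → E n) : ℝ := Metric.diam (range u)

/-- The boundary `∂M` of the surface; `Γ` is its image under `u`. -/
abbrev bdry (M : Type*) [TopologicalSpace M] [ChartedSpace (EuclideanHalfSpace 2) M] : Set M :=
  (𝓡∂ 2).boundary M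

/-- One-dimensional Hausdorff measure on `Γ = u(∂M)`, transported to `∂M` by the injective map
`u|_{∂M}`. -/
def bdryMeasure [MeasurableSpace M] (u : M → E n) : Measure (bdry M) :=
  Measure.comap (fun p : bdry M => u p) (μH[1])

/-- The unit tangent vector of `Γ` at `u p`, for `p ∈ ∂M` (up to the sign; it is
not meaningful at branch points). -/
def unitTangent (u : M → E n) (p : M) : E n :=
  ‖du u p (EuclideanSpace.single 1 1)‖⁻¹ • du u p (EuclideanSpace.single 1 1)

/-- The component normal to `Γ` of the image under `du_p` of an outward pointing vector. -/
def outwardVector (u : M → E n) (p : M) : E n :=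
  -(du u p (EuclideanSpace.single 0 1) -
    inner ℝ (du u p (EuclideanSpace.single 0 1)) (unitTangent u p) • unitTangent u p)

/-- `ν_M`, the outward pointing unit vector that is tangent to `M` and normal to `Γ`, at `u p`
for `p ∈ ∂M` (not meaningful at branch points). -/
def conormal (u : M → E n) (p : M) : E n := ‖outwardVector u p‖⁻¹ • outwardVector u p

/-- `div_M X` at `p`: the trace of `DX` over the tangent plane `du_p(T_pM)`. -/
def tangentialDiv (u : M → E n) (X : E n → E n) (p : M) : ℝ :=
  LinearMap.trace ℝ (E n)
    ((((LinearMap.range (du u p : E 2 →ₗ[ℝ] E n)).starProjection ∘L fderiv ℝ X (u p) :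
      E n →L[ℝ] E n)) : E n →ₗ[ℝ] E n)

/-- `H` is a (locally) integrable normal vector field that is the mean curvature vector of `M`, with
the sign convention `∫_M div_M X = ∫_M X · H` for `C¹` fields `X` with compact support in
`ℝⁿ ∖ Γ`. -/
def HasMeanCurvature [MeasurableSpace M] (u : M → E n) (H : M → E n) : Prop :=
  Integrable H (areaMeasure u) ∧
  (∀ᵐ p ∂(areaMeasure u), ∀ v : E 2, inner ℝ (H p) (du u p v) = 0) ∧
  ∀ X : E n → E n, ContDiff ℝ 1 X → HasCompactSupport X → Disjoint (tsupport X) (u '' bdry M) →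
    ∫ p, tangentialDiv u X p ∂(areaMeasure u) = ∫ p, inner ℝ (X (u p)) (H p) ∂(areaMeasure u)

/-- The divergence identity with boundary term,
`∫_M div_M X dA = ∫_M X · H dA + ∫_Γ X · ν_M dℋ¹` for every `C¹` vector field `X` on `ℝⁿ`. -/
def DivergenceIdentity [MeasurableSpace M] (u : M → E n) (H : M → E n) : Prop :=
  ∀ X : E n → E n, ContDiff ℝ 1 X →
    ∫ p, tangentialDiv u X p ∂(areaMeasure u) =
      ∫ p, inner ℝ (X (u p)) (H p) ∂(areaMeasure u) +
        ∫ p : bdry M, inner ℝ (X (u p)) (conormal u p) ∂(bdryMeasure u)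

/-- The area of the parallelogram spanned by `v` and `w`. -/
def parallelogramArea (v w : E n) : ℝ := √(‖v‖ ^ 2 * ‖w‖ ^ 2 - inner ℝ v w ^ 2)

/-- The area, with multiplicity, inside `B_r(x₀)` of the piece
`{x₀ + t (x - x₀) : x ∈ Γ, t ∈ T}` of the cone over `Γ` with vertex `x₀`: the integral over
`Γ × T` of the Jacobian of `(x, t) ↦ x₀ + t (x - x₀)`, whose partial derivatives are `x - x₀`
in `t` and `t τ` in the direction of the unit tangent `τ` of `Γ`. -/
def coneArea [MeasurableSpace M] (u : M → E n) (x₀ : E n) (T : Set ℝ) (r : ℝ) : ℝ≥0∞ :=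
  ∫⁻ p : bdry M, (∫⁻ t : ℝ in {t : ℝ | t ∈ T ∧ x₀ + t • (u p - x₀) ∈ Metric.ball x₀ r},
    ENNReal.ofReal (parallelogramArea (u p - x₀) (t • unitTangent u p))) ∂(bdryMeasure u)

/-- `m(r) = area(M' ∩ B_r(x₀)) / r²`, where `M'` is the union of `M` and the exterior cone
`{x₀ + t (x - x₀) : x ∈ Γ, t ≥ 1}`. -/
def extendedRatio [MeasurableSpace M] (u : M → E n) (x₀ : E n) (r : ℝ) : ℝ≥0∞ :=
  (surfaceArea u x₀ r + coneArea u x₀ (Ici 1) r) / ENNReal.ofReal (r ^ 2)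

/-- Property (P) with constants `α`, `Λ` for the balls centred at `x₀`. -/
def PropertyP [MeasurableSpace M] (u : M → E n) (H : M → E n) (x₀ : E n) (α Λ : ℝ) : Prop :=
  0 < α ∧ α ≤ 1 ∧ 0 ≤ Λ ∧ ∀ r : ℝ, 0 < r →
    ∫⁻ p in u ⁻¹' Metric.ball x₀ r, ‖H p‖ₑ ∂(areaMeasure u) ≤
      ENNReal.ofReal (α * Λ * r ^ (α + 1)) * extendedRatio u x₀ r

/-- If `A r` is the area of a surface in `B_r(x)`, the surface has density `θ` at `x`. -/
def HasDensity (A : ℝ → ℝ≥0∞) (θ : ℝ≥0∞) : Prop :=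
  Tendsto (fun r => A r / ENNReal.ofReal (Real.pi * r ^ 2)) (𝓝[>] 0) (𝓝 θ)

/-- The upper density, which is the density whenever the latter exists. -/
def upperDensity (A : ℝ → ℝ≥0∞) : ℝ≥0∞ :=
  limsup (fun r => A r / ENNReal.ofReal (Real.pi * r ^ 2)) (𝓝[>] 0)

end BranchedSurface

end

noncomputable section

namespace BranchedSurface

/-! ### The differential in a fixed chart, and finiteness of the branch set -/

section Charts

variable {n : ℕ} {M : Type*} [TopologicalSpace M] [ChartedSpace (EuclideanHalfSpace 2) M]

/-! The proof is the monotonicity formula for `M` extended by its exterior cone. The divergence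
identity is tested with `X = ψ(|x - x₀|²)(x - x₀)`, where `ψ(s)` approximates `(1 / max(σ², s) - 1 /
r²)⁺`. Since `div_M X = 2ψ + 2ψ' |w^T|²` with `w = x - x₀`, and `ψ' ≤ 0`, replacing `|w^T|²` by
`|w|²` bounds the divergence from below by `2(ψ + sψ')`. In the limit this is twice the difference
of the two indicator functions divided by `σ²` and `r²`, so the left side becomes a difference of
area ratios (`area_ratio_le`).

On the boundary, `w · ν_M` is at most the length of the component of `w` normal to `Γ`, which is the
Jacobian of the cone at `t = 1`. The weighted integral of this Jacobian is exactly twice the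
increase of the area ratio of the exterior cone (`exteriorConeRatio_eq_add`). Adding the cone
therefore absorbs the boundary term, and `m(σ) ≤ m(r) + curvature term` (`massRatio_le_add`).

This inequality is used in two ways. With (P), a discrete Grönwall argument shows that `exp(Λ r^α)
m(r)` is nondecreasing (`monotoneOn_exp_mul`). If the cone density is finite, the exterior cone
contributes nothing to `m` as `r → 0`, so `π Θ(M, x₀)` exists and is at most `exp(Λ σ^α) m(σ)`. For
`σ` so large that `M` lies in `B_σ(x₀)`, one compares `σ` with `r → ∞`: there `m(r)` is bounded by a
quantity tending to half the total mass of the cone density, which is at most `π Θ(C)`, and (P) at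
the single radius `σ` bounds the curvature term by `(αΛσ^α / 2) m(σ)` (`massRatio_mul_le`).
Combining the two and letting `σ` decrease to `r₀` gives the theorem when `x₀` lies in `u(M)`;
otherwise the density of `M` is zero. An infinite cone density is trivial. -/

theorem measurableSet_extChartAt_target (p : M) :
    MeasurableSet (extChartAt (𝓡∂ 2) p).target := by
  rw [extChartAt_target]
  exact (((chartAt (EuclideanHalfSpace 2) p).open_target.preimage
    (𝓡∂ 2).continuous_symm).measurableSet).inter (𝓡∂ 2).isClosed_range.measurableSet

variable [IsManifold (𝓡∂ 2) ∞ M]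

/-- The differential of `u` read in the fixed chart at `p`. -/
def chartDeriv (u : M → E n) (p : M) (y : E 2) : E 2 →L[ℝ] E n :=
  fderivWithin ℝ (u ∘ (extChartAt (𝓡∂ 2) p).symm) (range (𝓡∂ 2)) y

theorem contMDiffWithinAt_extChartAt_symm_one (p : M) {y : E 2}
    (hy : y ∈ (extChartAt (𝓡∂ 2) p).target) :
    ContMDiffWithinAt 𝓘(ℝ, E 2) (𝓡∂ 2) 1 (extChartAt (𝓡∂ 2) p).symm (range (𝓡∂ 2)) y := by
  have h := contMDiffOn_extChartAt_symm (I := 𝓡∂ 2) (n := 1) p y hy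
  exact h.mono_of_mem_nhdsWithin (extChartAt_target_mem_nhdsWithin_of_mem hy)

theorem contDiffWithinAt_comp_chart_symm {F : Type*} [NormedAddCommGroup F] [NormedSpace ℝ F]
    {f : M → F} {p : M} {y : E 2} (hy : y ∈ (extChartAt (𝓡∂ 2) p).target)
    (hf : ContMDiffAt (𝓡∂ 2) 𝓘(ℝ, F) 1 f ((extChartAt (𝓡∂ 2) p).symm y)) :
    ContDiffWithinAt ℝ 1 (f ∘ (extChartAt (𝓡∂ 2) p).symm) (range (𝓡∂ 2)) y := by
  rw [← contMDiffWithinAt_iff_contDiffWithinAt]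
  exact hf.comp_contMDiffWithinAt y (contMDiffWithinAt_extChartAt_symm_one p hy)

theorem fderivWithin_comp_chart_symm {F : Type*} [NormedAddCommGroup F] [NormedSpace ℝ F]
    {f : M → F} {p : M} {y : E 2} (hy : y ∈ (extChartAt (𝓡∂ 2) p).target)
    (hf : ContMDiffAt (𝓡∂ 2) 𝓘(ℝ, F) 1 f ((extChartAt (𝓡∂ 2) p).symm y)) :
    ∃ B : E 2 ≃L[ℝ] E 2,
      fderivWithin ℝ (f ∘ (extChartAt (𝓡∂ 2) p).symm) (range (𝓡∂ 2)) y =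
        (show E 2 →L[ℝ] F from mfderiv (𝓡∂ 2) 𝓘(ℝ, F) f ((extChartAt (𝓡∂ 2) p).symm y)) ∘L
          (B : E 2 →L[ℝ] E 2) := by
  obtain ⟨B, hB⟩ := isInvertible_mfderivWithin_extChartAt_symm (I := 𝓡∂ 2) hy
  refine ⟨B, ?_⟩
  have hu : UniqueMDiffWithinAt 𝓘(ℝ, E 2) (range (𝓡∂ 2)) y :=
    ((𝓡∂ 2).uniqueDiffOn y (extChartAt_target_subset_range p hy)).uniqueMDiffWithinAt
  have h1 := mfderiv_comp_mfderivWithin y (hf.mdifferentiableAt one_ne_zero)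
    ((contMDiffWithinAt_extChartAt_symm_one p hy).mdifferentiableWithinAt one_ne_zero) hu
  rw [mfderivWithin_eq_fderivWithin] at h1
  rw [h1, ← hB]
  rfl

/-- `du u q` is read in the preferred chart at `q`, which may jump with `q`. Range and injectivity
do not see the change of coordinates `B`, so they can be studied through `chartDeriv`, which is
continuous on one chart. -/
theorem chartDeriv_eq {u : M → E n} (hu : ContMDiff (𝓡∂ 2) 𝓘(ℝ, E n) 1 u) {p q : M}
    (hq : q ∈ (extChartAt (𝓡∂ 2) p).source) :
    ∃ B : E 2 ≃L[ℝ] E 2,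
      chartDeriv u p (extChartAt (𝓡∂ 2) p q) = du u q ∘L (B : E 2 →L[ℝ] E 2) := by
  have h := fderivWithin_comp_chart_symm (f := u) ((extChartAt (𝓡∂ 2) p).map_source hq) (hu _)
  rw [(extChartAt (𝓡∂ 2) p).left_inv hq] at h
  exact h

theorem range_chartDeriv {u : M → E n} (hu : ContMDiff (𝓡∂ 2) 𝓘(ℝ, E n) 1 u) {p q : M}
    (hq : q ∈ (extChartAt (𝓡∂ 2) p).source) :
    LinearMap.range (chartDeriv u p (extChartAt (𝓡∂ 2) p q) : E 2 →ₗ[ℝ] E n) =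
      LinearMap.range (du u q : E 2 →ₗ[ℝ] E n) := by
  obtain ⟨B, hB⟩ := chartDeriv_eq hu hq
  rw [hB]
  exact LinearMap.range_comp_of_range_eq_top _ (LinearMap.range_eq_top.2 B.surjective)

theorem injective_chartDeriv_iff {u : M → E n} (hu : ContMDiff (𝓡∂ 2) 𝓘(ℝ, E n) 1 u) {p q : M}
    (hq : q ∈ (extChartAt (𝓡∂ 2) p).source) :
    Function.Injective (chartDeriv u p (extChartAt (𝓡∂ 2) p q)) ↔ Function.Injective (du u q) := by
  obtain ⟨B, hB⟩ := chartDeriv_eq hu hq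
  rw [hB]
  exact B.injective_comp (du u q)

theorem continuousOn_chartDeriv {u : M → E n} (hu : ContMDiff (𝓡∂ 2) 𝓘(ℝ, E n) 1 u) (p : M) :
    ContinuousOn (chartDeriv u p) (extChartAt (𝓡∂ 2) p).target := by
  have h : ContDiffOn ℝ 1 (u ∘ (extChartAt (𝓡∂ 2) p).symm) (extChartAt (𝓡∂ 2) p).target :=
    fun y hy => (contDiffWithinAt_comp_chart_symm hy (hu _)).mono (extChartAt_target_subset_range p)
  refine (h.continuousOn_fderivWithin (uniqueDiffOn_extChartAt_target p) le_rfl).congr ?_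
  intro y hy
  exact fderivWithin_congr_set (extChartAt_target_eventuallyEq_of_mem hy).symm

theorem continuousOn_chartDeriv_comp {u : M → E n} (hu : ContMDiff (𝓡∂ 2) 𝓘(ℝ, E n) 1 u) (p : M) :
    ContinuousOn (fun q => chartDeriv u p (extChartAt (𝓡∂ 2) p q)) (extChartAt (𝓡∂ 2) p).source :=
  (continuousOn_chartDeriv hu p).comp (continuousOn_extChartAt p)
    (fun _ hq => (extChartAt (𝓡∂ 2) p).map_source hq)

/-- Near a branch point the differential is injective, except possibly at the point. -/
theorem IsBranchPoint.eventually_injective {u : M → E n}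
    (hu : ContMDiff (𝓡∂ 2) 𝓘(ℝ, E n) 1 u) {p : M} (hp : IsBranchPoint u p) :
    ∀ᶠ q in 𝓝 p, q ≠ p → Function.Injective (du u q) := by
  obtain ⟨m, z, R, a, f, hm, hzp, hz, hbij, heq⟩ := hp
  have hsymm : (extChartAt (𝓡∂ 2) p).symm (extChartAt (𝓡∂ 2) p p) = p :=
    (extChartAt (𝓡∂ 2) p).left_inv (mem_extChartAt_source p)
  have hy0 := mem_extChartAt_target (I := 𝓡∂ 2) p
  have hz0 : ContMDiffAt (𝓡∂ 2) 𝓘(ℝ, ℂ) 1 z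
      ((extChartAt (𝓡∂ 2) p).symm (extChartAt (𝓡∂ 2) p p)) := by rwa [hsymm]
  have hZ := contDiffWithinAt_comp_chart_symm hy0 hz0
  obtain ⟨B, hB⟩ := fderivWithin_comp_chart_symm hy0 hz0
  rw [hsymm] at hB
  have hinj0 : Function.Injective (fderivWithin ℝ (z ∘ (extChartAt (𝓡∂ 2) p).symm) (range (𝓡∂ 2))
      (extChartAt (𝓡∂ 2) p p)) := by
    rw [hB]
    exact hbij.1.comp B.injective
  have htend : Tendsto (extChartAt (𝓡∂ 2) p) (𝓝 p)
      (𝓝[range (𝓡∂ 2)] (extChartAt (𝓡∂ 2) p p)) :=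
    tendsto_nhdsWithin_iff.2 ⟨continuousAt_extChartAt p, Eventually.of_forall fun q => by
      simp [extChartAt]⟩
  have hrange : extChartAt (𝓡∂ 2) p p ∈ range (𝓡∂ 2) := extChartAt_target_subset_range p hy0
  have hcont : ContinuousWithinAt
      (fderivWithin ℝ (z ∘ (extChartAt (𝓡∂ 2) p).symm) (range (𝓡∂ 2))) (range (𝓡∂ 2))
      (extChartAt (𝓡∂ 2) p p) :=
    hZ.continuousWithinAt_fderivWithin (𝓡∂ 2).uniqueDiffOn one_ne_zero hrange
  have hinj : ∀ᶠ q in 𝓝 p, Function.Injective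
      (fderivWithin ℝ (z ∘ (extChartAt (𝓡∂ 2) p).symm) (range (𝓡∂ 2)) (extChartAt (𝓡∂ 2) p q)) :=
    htend.eventually (hcont.eventually
      (ContinuousLinearMap.isOpen_injective.mem_nhds hinj0))
  -- An injective differential is bounded below, so `z` takes its value at `p` only at `p` nearby.
  have hne : ∀ᶠ q in 𝓝 p, q ≠ p → z q ≠ 0 := by
    obtain ⟨K, -, hK⟩ := (LinearMap.injective_iff_antilipschitz _).1 hinj0
    have h1 := (hZ.differentiableWithinAt one_ne_zero).hasFDerivWithinAt.eventually_ne
      (c := 0) ⟨K, hK⟩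
    rw [sdiff_eq, nhdsWithin_inter', eventually_inf_principal] at h1
    filter_upwards [htend.eventually h1, extChartAt_source_mem_nhds (I := 𝓡∂ 2) p] with q h2 h3 hqp
    have h4 := h2 fun h => hqp ((extChartAt (𝓡∂ 2) p).injOn h3 (mem_extChartAt_source p) h)
    rwa [Function.comp_apply, (extChartAt (𝓡∂ 2) p).left_inv h3] at h4
  have hdiff : ∀ᶠ q in 𝓝 p, ContMDiffAt (𝓡∂ 2) 𝓘(ℝ, ℂ) 1 z q :=
    (contMDiffAt_iff_contMDiffAt_nhds (by simp)).1 hz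
  filter_upwards [hinj, hne, hdiff, heq.eventually_nhds,
    extChartAt_source_mem_nhds (I := 𝓡∂ 2) p] with q h1 h2 h3 h4 h5 hqp
  rw [← injective_chartDeriv_iff hu h5]
  set y := extChartAt (𝓡∂ 2) p q with hy
  have hyt : y ∈ (extChartAt (𝓡∂ 2) p).target := (extChartAt (𝓡∂ 2) p).map_source h5
  have hyq : (extChartAt (𝓡∂ 2) p).symm y = q := (extChartAt (𝓡∂ 2) p).left_inv h5
  have hyr : y ∈ range (𝓡∂ 2) := extChartAt_target_subset_range p hyt
  have hud : UniqueDiffWithinAt ℝ (range (𝓡∂ 2)) y := (𝓡∂ 2).uniqueDiffOn y hyr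
  have hZy := ((contDiffWithinAt_comp_chart_symm (f := z) hyt
    (by rwa [hyq])).differentiableWithinAt one_ne_zero).hasFDerivWithinAt
  have hUy := ((contDiffWithinAt_comp_chart_symm (f := u) hyt
    (hu _)).differentiableWithinAt one_ne_zero).hasFDerivWithinAt
  have hcs : Tendsto (extChartAt (𝓡∂ 2) p).symm (𝓝[range (𝓡∂ 2)] y) (𝓝 q) := by
    have := (contMDiffWithinAt_extChartAt_symm_one p hyt).continuousWithinAt
    rwa [ContinuousWithinAt, hyq] at this
  -- `L` extracts the `ℂ`-component. Differentiating `z ^ m = L u - L a` gives `m z ^ (m - 1) dz = L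
  -- ∘ du`, so the kernel of `du` lies in that of `dz` wherever `z ≠ 0`; `f` is never
  -- differentiated.
  let L : E n →L[ℝ] ℂ := (WithLp.fstL 2 ℝ ℂ (E (n - 2))) ∘L
    (R.symm.toContinuousLinearEquiv : E n →L[ℝ] WithLp 2 (ℂ × E (n - 2)))
  have hLU : (fun x => (z ∘ (extChartAt (𝓡∂ 2) p).symm) x ^ m) =ᶠ[𝓝[range (𝓡∂ 2)] y]
      fun x => L ((u ∘ (extChartAt (𝓡∂ 2) p).symm) x) - L a := by
    filter_upwards [hcs.eventually h4] with x hx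
    rw [← map_sub, Function.comp_apply, Function.comp_apply, hx]
    simp [L]
  have hder1 := hZy.pow m
  have hder2 := ((L.hasFDerivAt.comp_hasFDerivWithinAt y hUy).sub_const (L a)).congr_of_eventuallyEq
    hLU (hLU.self_of_nhdsWithin hyr)
  have hder := hud.eq hder1 hder2
  have hzq : (z ∘ (extChartAt (𝓡∂ 2) p).symm) y ≠ 0 := by
    rw [Function.comp_apply, hyq]; exact h2 hqp
  rw [injective_iff_map_eq_zero]
  intro v hv
  have hv' : fderivWithin ℝ (u ∘ (extChartAt (𝓡∂ 2) p).symm) (range (𝓡∂ 2)) y v = 0 := hv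
  have h6 := DFunLike.congr_fun hder v
  simp only [ContinuousLinearMap.comp_apply, hv', map_zero] at h6
  refine (injective_iff_map_eq_zero _).1 h1 v ?_
  have hm0 : m ≠ 0 := by lia
  generalize (z ∘ (extChartAt (𝓡∂ 2) p).symm) y = c at h6 hzq
  generalize fderivWithin ℝ (z ∘ (extChartAt (𝓡∂ 2) p).symm) (range (𝓡∂ 2)) y = D at h6
  simpa [hm0, hzq] using h6

/-- The set of points at which a branched immersion is not immersive is finite. -/
theorem IsBranchedImmersion.finite_not_injective [CompactSpace M] {u : M → E n}
    (hu : IsBranchedImmersion u) : {q : M | ¬ Function.Injective (du u q)}.Finite := by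
  have h : ∀ p : M, {q : M | q ≠ p → Function.Injective (du u q)} ∈ 𝓝 p := by
    intro p
    rcases hu.2 p with h | h
    · exact h.mono fun q hq _ => hq
    · exact h.eventually_injective hu.1
  obtain ⟨t, ht⟩ := CompactSpace.elim_nhds_subcover _ h
  refine t.finite_toSet.subset fun q hq => ?_
  have hq' : q ∈ ⋃ x ∈ t, {q : M | q ≠ x → Function.Injective (du u q)} := by
    rw [ht]; trivial
  simp only [mem_iUnion] at hq'
  obtain ⟨x, hx, hqx⟩ := hq'
  by_contra hqt
  exact hq (hqx fun h => hqt (h ▸ hx))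

end Charts

/-! ### Finiteness of the area measure and null sets of branch points -/

section Area

theorem jacobian_comp {n : ℕ} (L : E 2 →L[ℝ] E n) (B : E 2 →L[ℝ] E 2) :
    jacobian (L ∘L B) = |B.det| * jacobian L := by
  have h : ((ContinuousLinearMap.adjoint (L ∘L B) ∘L (L ∘L B) : E 2 →L[ℝ] E 2) :
      E 2 →ₗ[ℝ] E 2) = (ContinuousLinearMap.adjoint B : E 2 →ₗ[ℝ] E 2) ∘ₗ
        ((ContinuousLinearMap.adjoint L ∘L L : E 2 →L[ℝ] E 2) : E 2 →ₗ[ℝ] E 2) ∘ₗ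
          (B : E 2 →ₗ[ℝ] E 2) := by
    rw [ContinuousLinearMap.adjoint_comp]; rfl
  have hB : LinearMap.det (ContinuousLinearMap.adjoint B : E 2 →ₗ[ℝ] E 2) = B.det := by
    let b := EuclideanSpace.basisFun (Fin 2) ℝ
    have h1 := LinearMap.toMatrix_adjoint b b (B : E 2 →ₗ[ℝ] E 2)
    have h2 : LinearMap.adjoint (B : E 2 →ₗ[ℝ] E 2) =
        (ContinuousLinearMap.adjoint B : E 2 →ₗ[ℝ] E 2) := rfl
    rw [← h2, ← LinearMap.det_toMatrix b.toBasis, h1, Matrix.det_conjTranspose, star_trivial,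
      LinearMap.det_toMatrix]
  rw [jacobian, jacobian, h, LinearMap.det_comp, LinearMap.det_comp, hB]
  change √(B.det * (_ * B.det)) = _
  rw [show ∀ x : ℝ, B.det * (x * B.det) = B.det ^ 2 * x by intro x; ring,
    Real.sqrt_mul (sq_nonneg _), Real.sqrt_sq_eq_abs]

theorem continuous_jacobian {n : ℕ} : Continuous (jacobian : (E 2 →L[ℝ] E n) → ℝ) := by
  unfold jacobian
  refine Real.continuous_sqrt.comp ?_
  refine ContinuousLinearMap.continuous_det.comp ?_
  exact (ContinuousLinearMap.adjoint.continuous).clm_comp continuous_id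

variable {n : ℕ} {M : Type*} [TopologicalSpace M] [ChartedSpace (EuclideanHalfSpace 2) M]

/-- The coordinate change between two charts, and the chain rule for it. -/
theorem chartDeriv_coord_change [IsManifold (𝓡∂ 2) ∞ M] {u : M → E n} (hu : ContMDiff (𝓡∂ 2) 𝓘(ℝ, E n) 1 u) (p q : M)
    {y : E 2} (hy : y ∈ (extChartAt (𝓡∂ 2) q).target)
    (hyp : (extChartAt (𝓡∂ 2) q).symm y ∈ (extChartAt (𝓡∂ 2) p).source) :
    ∃ B : E 2 →L[ℝ] E 2,
      HasFDerivWithinAt (extChartAt (𝓡∂ 2) p ∘ (extChartAt (𝓡∂ 2) q).symm) B (range (𝓡∂ 2)) y ∧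
      chartDeriv u q y =
        chartDeriv u p (extChartAt (𝓡∂ 2) p ((extChartAt (𝓡∂ 2) q).symm y)) ∘L B := by
  have hyr : y ∈ range (𝓡∂ 2) := extChartAt_target_subset_range q hy
  have hud : UniqueDiffWithinAt ℝ (range (𝓡∂ 2)) y := (𝓡∂ 2).uniqueDiffOn y hyr
  have h1 := ((contDiffWithinAt_comp_chart_symm (f := extChartAt (𝓡∂ 2) p) hy
    (contMDiffAt_extChartAt' (by simpa [extChartAt] using hyp))).differentiableWithinAt
      one_ne_zero).hasFDerivWithinAt
  refine ⟨_, h1, ?_⟩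
  have h2 := ((contDiffWithinAt_comp_chart_symm (f := u) ((extChartAt (𝓡∂ 2) p).map_source hyp)
    (hu _)).differentiableWithinAt one_ne_zero).hasFDerivWithinAt
  have h3 := h2.comp (f := extChartAt (𝓡∂ 2) p ∘ (extChartAt (𝓡∂ 2) q).symm) y h1
    (fun x _ => by simp [extChartAt])
  have hcs : Tendsto (extChartAt (𝓡∂ 2) q).symm (𝓝[range (𝓡∂ 2)] y)
      (𝓝 ((extChartAt (𝓡∂ 2) q).symm y)) :=
    (contMDiffWithinAt_extChartAt_symm_one q hy).continuousWithinAt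
  have h4 : (u ∘ (extChartAt (𝓡∂ 2) q).symm) =ᶠ[𝓝[range (𝓡∂ 2)] y]
      (u ∘ (extChartAt (𝓡∂ 2) p).symm) ∘ (extChartAt (𝓡∂ 2) p ∘ (extChartAt (𝓡∂ 2) q).symm) := by
    filter_upwards [hcs.eventually ((isOpen_extChartAt_source p).mem_nhds hyp)] with x hx
    simp only [Function.comp_apply]
    rw [(extChartAt (𝓡∂ 2) p).left_inv hx]
  exact (h3.congr_of_eventuallyEq h4 (h4.self_of_nhdsWithin hyr)).fderivWithin hud

variable [MeasurableSpace M] [BorelSpace M]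

theorem chartArea_apply (u : M → E n) (p : M) {A : Set M} (hA : MeasurableSet A) :
    chartArea u p A = ∫⁻ y in (extChartAt (𝓡∂ 2) p).symm ⁻¹' A ∩ (extChartAt (𝓡∂ 2) p).target,
      ENNReal.ofReal (jacobian (chartDeriv u p y)) := by
  have h : AEMeasurable (extChartAt (𝓡∂ 2) p).symm
      (volume.restrict (extChartAt (𝓡∂ 2) p).target) :=
    (continuousOn_extChartAt_symm p).aemeasurable (measurableSet_extChartAt_target p)
  rw [chartArea, Measure.map_apply_of_aemeasurable
    (h.mono_ac (withDensity_absolutelyContinuous _ _)) hA, withDensity_apply',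
    Measure.restrict_restrict' (measurableSet_extChartAt_target p)]
  rfl

theorem measurableSet_preimage_chart_symm (p : M) {A : Set M} (hA : MeasurableSet A) :
    MeasurableSet ((extChartAt (𝓡∂ 2) p).symm ⁻¹' A ∩ (extChartAt (𝓡∂ 2) p).target) := by
  have h := (measurableSet_extChartAt_target p).subtype_image
    ((continuousOn_extChartAt_symm (I := 𝓡∂ 2) p).domRestrict.measurable hA)
  rwa [domRestrict_eq, preimage_comp, Subtype.image_preimage_coe, inter_comm] at h

variable [IsManifold (𝓡∂ 2) ∞ M]

/-- The area measures of two charts agree on the overlap; this is one of the inequalities. -/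
theorem chartArea_le {u : M → E n} (hu : ContMDiff (𝓡∂ 2) 𝓘(ℝ, E n) 1 u) (p q : M) {A : Set M}
    (hA : MeasurableSet A) (hAp : A ⊆ (extChartAt (𝓡∂ 2) p).source) :
    chartArea u q A ≤ chartArea u p A := by
  rw [chartArea_apply u q hA, chartArea_apply u p hA]
  set T := (extChartAt (𝓡∂ 2) q).symm ⁻¹' A ∩ (extChartAt (𝓡∂ 2) q).target
  have hT : MeasurableSet T := measurableSet_preimage_chart_symm q hA
  choose! B hB1 hB2 using fun y (hy : y ∈ T) => chartDeriv_coord_change hu p q hy.2 (hAp hy.1)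
  have hinj : InjOn (extChartAt (𝓡∂ 2) p ∘ (extChartAt (𝓡∂ 2) q).symm) T := by
    intro x hx y hy hxy
    exact (extChartAt (𝓡∂ 2) q).symm.injOn hx.2 hy.2
      ((extChartAt (𝓡∂ 2) p).injOn (hAp hx.1) (hAp hy.1) hxy)
  -- Change of variables by the coordinate change; its determinant is the factor from
  -- `jacobian_comp`.
  have hcov := lintegral_image_eq_lintegral_abs_det_fderiv_mul volume hT
    (fun y hy => (hB1 y hy).mono (inter_subset_right.trans (extChartAt_target_subset_range q)))
    hinj (fun y => ENNReal.ofReal (jacobian (chartDeriv u p y)))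
  calc _ = ∫⁻ y in T, ENNReal.ofReal |(B y).det| * ENNReal.ofReal (jacobian (chartDeriv u p
          ((extChartAt (𝓡∂ 2) p ∘ (extChartAt (𝓡∂ 2) q).symm) y))) := by
        refine setLIntegral_congr_fun hT fun y hy => ?_
        rw [hB2 y hy, jacobian_comp, ENNReal.ofReal_mul (abs_nonneg _)]
        rfl
    _ = _ := hcov.symm
    _ ≤ _ := by
        refine lintegral_mono_set ?_
        rintro _ ⟨y, hy, rfl⟩
        refine ⟨?_, (extChartAt (𝓡∂ 2) p).map_source (hAp hy.1)⟩
        rw [mem_preimage, Function.comp_apply, (extChartAt (𝓡∂ 2) p).left_inv (hAp hy.1)]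
        exact hy.1

/-- A whole chart may have infinite `chartArea`. The neighbourhood is cut down to a unit coordinate
ball on which the continuous Jacobian exceeds its value at `p` by less than one. -/
theorem exists_nhds_chartArea_lt_top {u : M → E n} (hu : ContMDiff (𝓡∂ 2) 𝓘(ℝ, E n) 1 u) (p : M) :
    ∃ U : Set M, IsOpen U ∧ p ∈ U ∧ U ⊆ (extChartAt (𝓡∂ 2) p).source ∧ chartArea u p U < ⊤ := by
  have hs := isOpen_extChartAt_source (I := 𝓡∂ 2) p
  have h1 : ContinuousOn (fun q => (extChartAt (𝓡∂ 2) p q,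
      jacobian (chartDeriv u p (extChartAt (𝓡∂ 2) p q)))) (extChartAt (𝓡∂ 2) p).source :=
    (continuousOn_extChartAt p).prodMk
      (continuous_jacobian.comp_continuousOn (continuousOn_chartDeriv_comp hu p))
  set C := jacobian (chartDeriv u p (extChartAt (𝓡∂ 2) p p)) + 1 with hC
  set V := Metric.ball (extChartAt (𝓡∂ 2) p p) 1 ×ˢ Iio C
  have hV : IsOpen V := Metric.isOpen_ball.prod isOpen_Iio
  refine ⟨_, h1.isOpen_inter_preimage hs hV, ⟨mem_extChartAt_source p, ?_⟩, inter_subset_left, ?_⟩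
  · simp [V, C]
  · rw [chartArea_apply u p (h1.isOpen_inter_preimage hs hV).measurableSet]
    set T := (extChartAt (𝓡∂ 2) p).symm ⁻¹' ((extChartAt (𝓡∂ 2) p).source ∩
      (fun q => (extChartAt (𝓡∂ 2) p q,
        jacobian (chartDeriv u p (extChartAt (𝓡∂ 2) p q)))) ⁻¹' V) ∩ (extChartAt (𝓡∂ 2) p).target
    have hT : MeasurableSet T :=
      measurableSet_preimage_chart_symm p (h1.isOpen_inter_preimage hs hV).measurableSet
    have hTV : ∀ y ∈ T, y ∈ Metric.ball (extChartAt (𝓡∂ 2) p p) 1 ∧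
        jacobian (chartDeriv u p y) < C := by
      rintro y ⟨⟨-, hy⟩, hyt⟩
      have h2 : (extChartAt (𝓡∂ 2) p) ((extChartAt (𝓡∂ 2) p).symm y) = y :=
        (extChartAt (𝓡∂ 2) p).right_inv hyt
      simp only [mem_preimage] at hy
      rwa [h2] at hy
    calc _ ≤ ∫⁻ _ in T, ENNReal.ofReal C :=
          setLIntegral_mono measurable_const fun y hy => ENNReal.ofReal_le_ofReal (hTV y hy).2.le
      _ ≤ ENNReal.ofReal C * volume (Metric.ball (extChartAt (𝓡∂ 2) p p) 1) := by
          rw [setLIntegral_const]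
          gcongr
          exact fun y hy => (hTV y hy).1
      _ < ⊤ := ENNReal.mul_lt_top ENNReal.ofReal_lt_top measure_ball_lt_top

/-- The area measure is dominated by finitely many finite pieces. -/
theorem exists_areaMeasure_le [CompactSpace M] {u : M → E n}
    (hu : ContMDiff (𝓡∂ 2) 𝓘(ℝ, E n) 1 u) :
    ∃ (t : Finset M) (U : M → Set M), (∀ p ∈ t, chartArea u p (U p) < ⊤) ∧
      areaMeasure u ≤ ∑ p ∈ t, (chartArea u p).restrict (U p) := by
  choose U hUo hpU hUs hUf using exists_nhds_chartArea_lt_top hu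
  obtain ⟨t, ht⟩ := CompactSpace.elim_nhds_subcover U fun p => (hUo p).mem_nhds (hpU p)
  refine ⟨t, U, fun p _ => hUf p, iSup_le fun q => ?_⟩
  refine Measure.le_intro fun A hA _ => ?_
  calc chartArea u q A ≤ chartArea u q (⋃ p ∈ t, A ∩ U p) := by
        refine measure_mono fun x hx => ?_
        have hx' : x ∈ ⋃ p ∈ t, U p := by rw [ht]; trivial
        simp only [mem_iUnion, mem_inter_iff, exists_prop] at hx' ⊢
        obtain ⟨p, hp, hxp⟩ := hx'
        exact ⟨p, hp, hx, hxp⟩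
    _ ≤ ∑ p ∈ t, chartArea u q (A ∩ U p) := measure_biUnion_finset_le _ _
    _ ≤ ∑ p ∈ t, chartArea u p (A ∩ U p) := Finset.sum_le_sum fun p _ =>
        chartArea_le hu p q (hA.inter (hUo p).measurableSet) (inter_subset_right.trans (hUs p))
    _ = _ := by
        rw [Measure.finsetSum_apply]
        exact Finset.sum_congr rfl fun p _ => (Measure.restrict_apply hA).symm

theorem isFiniteMeasure_areaMeasure [CompactSpace M] {u : M → E n}
    (hu : ContMDiff (𝓡∂ 2) 𝓘(ℝ, E n) 1 u) : IsFiniteMeasure (areaMeasure u) := by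
  obtain ⟨t, U, hU, hle⟩ := exists_areaMeasure_le hu
  refine ⟨(hle univ).trans_lt ?_⟩
  rw [Measure.finsetSum_apply]
  exact ENNReal.sum_lt_top.2 fun p hp => by simpa using hU p hp

theorem areaMeasure_singleton [CompactSpace M] [T1Space M] {u : M → E n}
    (hu : ContMDiff (𝓡∂ 2) 𝓘(ℝ, E n) 1 u) (x : M) : areaMeasure u {x} = 0 := by
  obtain ⟨t, U, -, hle⟩ := exists_areaMeasure_le hu
  refine le_antisymm ((hle {x}).trans ?_) bot_le
  rw [Measure.finsetSum_apply]
  refine (Finset.sum_eq_zero fun p _ => ?_).le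
  refine le_antisymm ((Measure.restrict_apply_le _ _).trans ?_) bot_le
  rw [chartArea_apply u p (measurableSet_singleton x)]
  refine (setLIntegral_measure_zero _ _ (Set.Subsingleton.measure_zero ?_ _)).le
  rintro y ⟨hy, hyt⟩ z ⟨hz, hzt⟩
  exact (extChartAt (𝓡∂ 2) p).symm.injOn hyt hzt ((show _ = x from hy).trans (show _ = x from hz).symm)

/-- A branched immersion is immersive almost everywhere. -/
theorem IsBranchedImmersion.ae_injective [CompactSpace M] [T1Space M] {u : M → E n}
    (hu : IsBranchedImmersion u) : ∀ᵐ q ∂(areaMeasure u), Function.Injective (du u q) := by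
  rw [ae_iff]
  have h := hu.finite_not_injective
  rw [← biUnion_of_singleton {q : M | ¬ Function.Injective (du u q)}]
  exact (measure_biUnion_null_iff h.countable).2 fun x _ => areaMeasure_singleton hu.1 x

theorem IsBranchedImmersion.ae_bdry_injective [CompactSpace M] [T1Space M] {u : M → E n}
    (hu : IsBranchedImmersion u) :
    ∀ᵐ q : bdry M ∂(bdryMeasure u), Function.Injective (du u (q : M)) := by
  rw [ae_iff]
  have h : {q : bdry M | ¬ Function.Injective (du u (q : M))}.Finite :=
    hu.finite_not_injective.preimage Subtype.val_injective.injOn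
  by_cases hc : Function.Injective (fun p : bdry M => u p) ∧
      ∀ s, MeasurableSet s → NullMeasurableSet ((fun p : bdry M => u p) '' s) μH[1]
  · have := Measure.nullSingletonClass_hausdorff (E n) one_pos
    rw [bdryMeasure, Measure.comap_apply₀ _ _ hc.1 hc.2 h.measurableSet.nullMeasurableSet]
    exact (h.image _).measure_zero _
  -- Otherwise `Measure.comap` takes its default value, the zero measure.
  · rw [bdryMeasure, Measure.comap, dif_neg hc, Measure.coe_zero, Pi.zero_apply]

end Area

/-! ### Tangential divergence of radial fields and the conormal bound -/

section Divergence

variable {n : ℕ}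

/-- The explicit Gram formula for the quadratic form of the projection onto the range of `L`. -/
def gramQuotient (L : E 2 →L[ℝ] E n) (w : E n) : ℝ :=
  (‖L (EuclideanSpace.single 1 1)‖ ^ 2 * inner ℝ w (L (EuclideanSpace.single 0 1)) ^ 2
    - 2 * inner ℝ (L (EuclideanSpace.single 0 1)) (L (EuclideanSpace.single 1 1)) *
      inner ℝ w (L (EuclideanSpace.single 0 1)) * inner ℝ w (L (EuclideanSpace.single 1 1))
    + ‖L (EuclideanSpace.single 0 1)‖ ^ 2 * inner ℝ w (L (EuclideanSpace.single 1 1)) ^ 2) /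
  (‖L (EuclideanSpace.single 0 1)‖ ^ 2 * ‖L (EuclideanSpace.single 1 1)‖ ^ 2
    - inner ℝ (L (EuclideanSpace.single 0 1)) (L (EuclideanSpace.single 1 1)) ^ 2)

/-- Expresses the tangential part of `w` rationally in the columns of `L`, which makes its
measurability in the base point visible. -/
theorem inner_starProjection_range_eq {L : E 2 →L[ℝ] E n} (hL : Function.Injective L) (w : E n) :
    inner ℝ w ((LinearMap.range (L : E 2 →ₗ[ℝ] E n)).starProjection w) = gramQuotient L w := by
  have hsum : ∀ v : E 2, L v = v 0 • L (EuclideanSpace.single 0 1) +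
      v 1 • L (EuclideanSpace.single 1 1) := by
    intro v
    rw [← map_smul, ← map_smul, ← map_add]
    congr 1
    ext i
    fin_cases i <;> simp
  have hne : ∀ c d : ℝ, c • L (EuclideanSpace.single 0 1) + d • L (EuclideanSpace.single 1 1) = 0 →
      c = 0 ∧ d = 0 := by
    intro c d h
    have h1 : L (!₂[c, d]) = 0 := by rw [hsum]; simpa using h
    have h2 := (injective_iff_map_eq_zero L).1 hL _ h1
    exact ⟨by simpa using congrArg (fun v : E 2 => v 0) h2,
      by simpa using congrArg (fun v : E 2 => v 1) h2⟩
  have hmem : ∀ c d : ℝ, c • L (EuclideanSpace.single 0 1) + d • L (EuclideanSpace.single 1 1) ∈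
      LinearMap.range (L : E 2 →ₗ[ℝ] E n) := by
    intro c d
    refine ⟨!₂[c, d], ?_⟩
    change L (!₂[c, d]) = _
    rw [hsum]; simp
  unfold gramQuotient
  generalize L (EuclideanSpace.single 0 1) = a at *
  generalize L (EuclideanSpace.single 1 1) = b at *
  have haa : inner ℝ a a = ‖a‖ ^ 2 := real_inner_self_eq_norm_sq a
  have hbb : inner ℝ b b = ‖b‖ ^ 2 := real_inner_self_eq_norm_sq b
  have hba : inner ℝ b a = inner ℝ a b := real_inner_comm a b
  -- The vector `‖b‖² a - ⟨a, b⟩ b` has squared norm `‖b‖²` times the Gram determinant, so a zero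
  -- determinant would make `a` and `b` dependent.
  have hD : ‖a‖ ^ 2 * ‖b‖ ^ 2 - inner ℝ a b ^ 2 ≠ 0 := by
    intro h
    have h1 : inner ℝ ((‖b‖ ^ 2) • a + (-inner ℝ a b) • b) ((‖b‖ ^ 2) • a + (-inner ℝ a b) • b)
        = (0 : ℝ) := by
      simp only [inner_add_left, inner_add_right, inner_smul_left, inner_smul_right, haa, hbb, hba]
      simp
      linear_combination ‖b‖ ^ 2 * h
    have h2 := (hne _ _ (inner_self_eq_zero.1 h1)).1
    have hb : b = 0 := by simpa using h2
    exact one_ne_zero (hne 0 1 (by simp [hb])).2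
  set D := ‖a‖ ^ 2 * ‖b‖ ^ 2 - inner ℝ a b ^ 2 with hDdef
  -- `c` and `d` solve the normal equations by Cramer's rule, so `c • a + d • b` is the projection
  -- of `w`.
  set c := (‖b‖ ^ 2 * inner ℝ w a - inner ℝ a b * inner ℝ w b) / D with hc
  set d := (‖a‖ ^ 2 * inner ℝ w b - inner ℝ a b * inner ℝ w a) / D with hd
  have hcD : c * D = ‖b‖ ^ 2 * inner ℝ w a - inner ℝ a b * inner ℝ w b := div_mul_cancel₀ _ hD
  have hdD : d * D = ‖a‖ ^ 2 * inner ℝ w b - inner ℝ a b * inner ℝ w a := div_mul_cancel₀ _ hD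
  have ha : inner ℝ (w - (c • a + d • b)) a = (0 : ℝ) := by
    apply mul_right_cancel₀ hD
    simp only [inner_sub_left, inner_add_left, inner_smul_left, haa, hba, conj_trivial, zero_mul]
    linear_combination (-‖a‖ ^ 2) * hcD - inner ℝ a b * hdD + inner ℝ w a * hDdef
  have hb : inner ℝ (w - (c • a + d • b)) b = (0 : ℝ) := by
    apply mul_right_cancel₀ hD
    simp only [inner_sub_left, inner_add_left, inner_smul_left, hbb, conj_trivial, zero_mul]
    linear_combination (-‖b‖ ^ 2) * hdD - inner ℝ a b * hcD + inner ℝ w b * hDdef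
  have hP := Submodule.eq_starProjection_of_mem_of_inner_eq_zero
    (K := LinearMap.range (L : E 2 →ₗ[ℝ] E n)) (u := w) (hmem c d) (by
      rintro _ ⟨v, rfl⟩
      change inner ℝ (w - (c • a + d • b)) (L v) = (0 : ℝ)
      rw [hsum, inner_add_right, inner_smul_right, inner_smul_right, ha, hb]
      simp)
  rw [hP, inner_add_right, inner_smul_right, inner_smul_right, eq_div_iff hD]
  linear_combination inner ℝ w a * hcD + inner ℝ w b * hdD

theorem abs_inner_starProjection_le (K : Submodule ℝ (E n)) (w : E n) :
    |inner ℝ w (K.starProjection w)| ≤ ‖w‖ ^ 2 := by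
  refine (abs_real_inner_le_norm _ _).trans ?_
  rw [sq]
  exact mul_le_mul_of_nonneg_left (K.norm_starProjection_apply_le w) (norm_nonneg _)

theorem hasFDerivAt_radial (x₀ : E n) {ψ : ℝ → ℝ} {ψ' : ℝ} {x : E n}
    (h : HasDerivAt ψ ψ' (‖x - x₀‖ ^ 2)) :
    HasFDerivAt (fun x => ψ (‖x - x₀‖ ^ 2) • (x - x₀))
      (ψ (‖x - x₀‖ ^ 2) • ContinuousLinearMap.id ℝ (E n) +
        ((2 * ψ') • innerSL ℝ (x - x₀)).smulRight (x - x₀)) x := by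
  have h1 : HasFDerivAt (fun x : E n => x - x₀) (ContinuousLinearMap.id ℝ (E n)) x :=
    (hasFDerivAt_id x).sub_const x₀
  have h2 := (h.comp_hasFDerivAt x h1.norm_sq).smul h1
  refine h2.congr_fderiv (ContinuousLinearMap.ext fun v => ?_)
  simp
  congr 1
  ring

variable {M : Type*} [TopologicalSpace M] [ChartedSpace (EuclideanHalfSpace 2) M]

/-- The derivative of the field is a multiple of the identity plus a rank-one map. After projection
the first has trace `ψ` times the dimension of the tangent plane, which is two at immersed points.
-/
theorem tangentialDiv_radial {u : M → E n} {p : M} (hp : Function.Injective (du u p)) (x₀ : E n)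
    {ψ : ℝ → ℝ} {ψ' : ℝ} (h : HasDerivAt ψ ψ' (‖u p - x₀‖ ^ 2)) :
    tangentialDiv u (fun x => ψ (‖x - x₀‖ ^ 2) • (x - x₀)) p =
      2 * ψ (‖u p - x₀‖ ^ 2) + 2 * ψ' *
        inner ℝ (u p - x₀)
          ((LinearMap.range (du u p : E 2 →ₗ[ℝ] E n)).starProjection (u p - x₀)) := by
  rw [tangentialDiv, (hasFDerivAt_radial x₀ h).fderiv]
  set K := LinearMap.range (du u p : E 2 →ₗ[ℝ] E n) with hK
  set w := u p - x₀
  have hdec : ((K.starProjection ∘L (ψ (‖w‖ ^ 2) • ContinuousLinearMap.id ℝ (E n) +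
        ((2 * ψ') • innerSL ℝ w).smulRight w) : E n →L[ℝ] E n) : E n →ₗ[ℝ] E n) =
      ψ (‖w‖ ^ 2) • (K.starProjection : E n →ₗ[ℝ] E n) +
        (((2 * ψ') • innerSL ℝ w : E n →L[ℝ] ℝ) : E n →ₗ[ℝ] ℝ).smulRight
          (K.starProjection w) := by
    ext v
    simp
  have hproj : LinearMap.IsProj K (K.starProjection : E n →ₗ[ℝ] E n) :=
    ⟨fun x => K.starProjection_apply_mem x, fun x hx => Submodule.starProjection_eq_self_iff.2 hx⟩
  have hrank : Module.finrank ℝ K = 2 := by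
    rw [hK, LinearMap.finrank_range_of_inj hp]; simp
  rw [hdec, map_add, map_smul, hproj.trace, LinearMap.trace_smulRight, hrank]
  simp
  ring

/-- The conormal has norm at most one and is orthogonal to the tangent `τ`, so it only sees the
component of `w` normal to `τ`, whose length is the parallelogram area because `τ` is a unit vector.
-/
theorem conormal_inner_le {u : M → E n} {p : M} (hp : Function.Injective (du u p)) (w : E n) :
    inner ℝ w (conormal u p) ≤ parallelogramArea w (unitTangent u p) := by
  have hne : du u p (EuclideanSpace.single 1 1) ≠ 0 := by
    intro h
    have := (injective_iff_map_eq_zero (du u p)).1 hp _ h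
    simpa using congrArg (fun v : E 2 => v 1) this
  have hτ : ‖unitTangent u p‖ = 1 := by
    rw [unitTangent, norm_smul, norm_inv, norm_norm, inv_mul_cancel₀ (norm_ne_zero_iff.2 hne)]
  have hτ2 : inner ℝ (unitTangent u p) (unitTangent u p) = (1 : ℝ) := by
    rw [real_inner_self_eq_norm_sq, hτ, one_pow]
  have hperp : inner ℝ (unitTangent u p) (conormal u p) = (0 : ℝ) := by
    rw [conormal, inner_smul_right, outwardVector, inner_neg_right, inner_sub_right,
      inner_smul_right, hτ2, real_inner_comm]
    ring
  have hν : ‖conormal u p‖ ≤ 1 := by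
    rw [conormal, norm_smul, norm_inv, norm_norm]
    exact inv_mul_le_one
  generalize unitTangent u p = τ at *
  generalize conormal u p = ν at *
  have h1 : inner ℝ w ν = inner ℝ (w - inner ℝ w τ • τ) ν := by
    rw [inner_sub_left, inner_smul_left, hperp]; simp
  have h2 : ‖w - inner ℝ w τ • τ‖ = parallelogramArea w τ := by
    rw [parallelogramArea, hτ, ← Real.sqrt_sq (norm_nonneg (w - inner ℝ w τ • τ))]
    congr 1
    rw [← real_inner_self_eq_norm_sq, inner_sub_left, inner_sub_right, inner_sub_right]
    simp only [inner_smul_left, inner_smul_right, hτ2, real_inner_self_eq_norm_sq,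
      real_inner_comm w τ]
    simp
    ring
  rw [h1, ← h2]
  exact (real_inner_le_norm _ _).trans (mul_le_of_le_one_right (norm_nonneg _) hν)

theorem aemeasurable_inner_starProjection [T2Space M] [CompactSpace M] [IsManifold (𝓡∂ 2) ∞ M]
    [MeasurableSpace M] [BorelSpace M] {u : M → E n} (hu : IsBranchedImmersion u) (x₀ : E n) :
    AEMeasurable (fun p => inner ℝ (u p - x₀)
      ((LinearMap.range (du u p : E 2 →ₗ[ℝ] E n)).starProjection (u p - x₀))) (areaMeasure u) := by
  obtain ⟨t, ht⟩ := CompactSpace.elim_nhds_subcover (fun p => (extChartAt (𝓡∂ 2) p).source)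
    fun p : M => extChartAt_source_mem_nhds p
  have hcov : (⋃ p : t, (extChartAt (𝓡∂ 2) (p : M)).source) = univ := by
    rw [← top_eq_univ, ← ht, iUnion_subtype]
  rw [← Measure.restrict_univ (μ := areaMeasure u), ← hcov, aemeasurable_iUnion_iff]
  rintro ⟨p, -⟩
  have hs : MeasurableSet (extChartAt (𝓡∂ 2) p).source :=
    (isOpen_extChartAt_source p).measurableSet
  have hL : ∀ v : E 2, ContinuousOn (fun q => chartDeriv u p (extChartAt (𝓡∂ 2) p q) v)
      (extChartAt (𝓡∂ 2) p).source := fun v =>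
    (continuousOn_chartDeriv_comp hu.1 p).clm_apply continuousOn_const
  have hw : ContinuousOn (fun q => u q - x₀) (extChartAt (𝓡∂ 2) p).source :=
    (hu.1.continuous.sub continuous_const).continuousOn
  have hg : AEMeasurable (fun q => gramQuotient (chartDeriv u p (extChartAt (𝓡∂ 2) p q)) (u q - x₀))
      ((areaMeasure u).restrict (extChartAt (𝓡∂ 2) p).source) := by
    refine AEMeasurable.div (ContinuousOn.aemeasurable ?_ hs) (ContinuousOn.aemeasurable ?_ hs)
    · exact ((((hL _).norm.pow 2).mul ((hw.inner (hL _)).pow 2)).sub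
        (((continuousOn_const.mul ((hL _).inner (hL _))).mul (hw.inner (hL _))).mul
          (hw.inner (hL _)))).add (((hL _).norm.pow 2).mul ((hw.inner (hL _)).pow 2))
    · exact (((hL _).norm.pow 2).mul ((hL _).norm.pow 2)).sub (((hL _).inner (hL _)).pow 2)
  refine hg.congr ?_
  filter_upwards [ae_restrict_of_ae hu.ae_injective, ae_restrict_mem hs] with q h1 h2
  rw [← inner_starProjection_range_eq ((injective_chartDeriv_iff hu.1 h2).2 h1)]
  congr! 3
  exact range_chartDeriv hu.1 h2

end Divergence

/-! ### Truncated radial weights and their smooth approximation -/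

section Cutoff

/-- The truncated radial weight, as a function of the squared radius. -/
def radialWeight (a b s : ℝ) : ℝ := max ((max a s)⁻¹ - b⁻¹) 0

/-- A continuous approximation of the indicator function of `(a, b)`. -/
def ramp (a b : ℝ) (j : ℕ) (v : ℝ) : ℝ := min 1 (j * max 0 (min (v - a) (b - v)))

/-- The derivative, up to the sign, of the `C¹` approximations of `radialWeight`. -/
def rampSlope (a b : ℝ) (j : ℕ) (v : ℝ) : ℝ := ramp a b j v / (max a v) ^ 2

/-- `C¹` approximations of `radialWeight`. -/
def smoothWeight (a b : ℝ) (j : ℕ) (s : ℝ) : ℝ := ∫ v in s..b, rampSlope a b j v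

variable {a b : ℝ}

theorem ramp_nonneg (j : ℕ) (v : ℝ) : 0 ≤ ramp a b j v :=
  le_min zero_le_one (mul_nonneg (Nat.cast_nonneg _) (le_max_left _ _))

theorem ramp_le_one (j : ℕ) (v : ℝ) : ramp a b j v ≤ 1 := min_le_left _ _

theorem ramp_eq_zero (j : ℕ) {v : ℝ} (hv : v ≤ a ∨ b ≤ v) : ramp a b j v = 0 := by
  have : min (v - a) (b - v) ≤ 0 := by
    rcases hv with h | h
    · exact (min_le_left _ _).trans (by linarith)
    · exact (min_le_right _ _).trans (by linarith)
  simp [ramp, max_eq_left this]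

theorem tendsto_ramp {v : ℝ} (h1 : a < v) (h2 : v < b) :
    Tendsto (fun j => ramp a b j v) atTop (𝓝 1) := by
  have hpos : 0 < max 0 (min (v - a) (b - v)) :=
    lt_max_of_lt_right (lt_min (by linarith) (by linarith))
  obtain ⟨N, hN⟩ := exists_nat_gt (max 0 (min (v - a) (b - v)))⁻¹
  refine tendsto_const_nhds.congr' ?_
  filter_upwards [eventually_ge_atTop N] with j hj
  have hj' : (N : ℝ) ≤ j := by exact_mod_cast hj
  rw [ramp, min_eq_left]
  rw [← inv_mul_cancel₀ hpos.ne']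
  exact mul_le_mul_of_nonneg_right (hN.le.trans hj') hpos.le

theorem continuous_rampSlope (ha : 0 < a) (j : ℕ) : Continuous (rampSlope a b j) := by
  unfold rampSlope ramp
  refine Continuous.div (by fun_prop) (by fun_prop) fun v => ?_
  have : 0 < max a v := lt_max_of_lt_left ha
  positivity

theorem rampSlope_nonneg (j : ℕ) (v : ℝ) : 0 ≤ rampSlope a b j v :=
  div_nonneg (ramp_nonneg j v) (sq_nonneg _)

theorem rampSlope_le (ha : 0 < a) (j : ℕ) (v : ℝ) : rampSlope a b j v ≤ ((max a v) ^ 2)⁻¹ := by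
  rw [rampSlope, div_eq_mul_inv]
  exact mul_le_of_le_one_left (by positivity) (ramp_le_one j v)

/-- A bound uniform in `j`, for dominated convergence. -/
theorem mul_rampSlope_le (ha : 0 < a) (j : ℕ) (v : ℝ) : v * rampSlope a b j v ≤ a⁻¹ := by
  have hm : 0 < max a v := lt_max_of_lt_left ha
  calc v * rampSlope a b j v ≤ max a v * ((max a v) ^ 2)⁻¹ :=
        mul_le_mul (le_max_right _ _) (rampSlope_le ha j v) (rampSlope_nonneg j v) hm.le
    _ = (max a v)⁻¹ := by field_simp
    _ ≤ a⁻¹ := inv_anti₀ ha (le_max_left _ _)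

theorem hasDerivAt_smoothWeight (ha : 0 < a) (j : ℕ) (s : ℝ) :
    HasDerivAt (smoothWeight a b j) (-rampSlope a b j s) s := by
  have hc := continuous_rampSlope (b := b) ha j
  exact intervalIntegral.integral_hasDerivAt_left (hc.intervalIntegrable _ _)
    hc.aestronglyMeasurable.stronglyMeasurableAtFilter hc.continuousAt

theorem smoothWeight_of_le (ha : 0 < a) (j : ℕ) {s : ℝ} (hs : s ≤ a) :
    smoothWeight a b j s = smoothWeight a b j a := by
  have hc := continuous_rampSlope (b := b) ha j
  rw [smoothWeight, smoothWeight, ← intervalIntegral.integral_add_adjacent_intervals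
    (hc.intervalIntegrable s a) (hc.intervalIntegrable a b), add_eq_right]
  refine intervalIntegral.integral_zero_ae (Eventually.of_forall fun v hv => ?_)
  rw [uIoc_of_le hs] at hv
  rw [rampSlope, ramp_eq_zero j (Or.inl hv.2), zero_div]

theorem smoothWeight_of_ge (j : ℕ) {s : ℝ} (hs : b ≤ s) : smoothWeight a b j s = 0 := by
  refine intervalIntegral.integral_zero_ae (Eventually.of_forall fun v hv => ?_)
  rw [uIoc_comm, uIoc_of_le hs] at hv
  rw [rampSlope, ramp_eq_zero j (Or.inr hv.1.le), zero_div]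

theorem integral_inv_sq (ha : 0 < a) {s : ℝ} (hs : a ≤ s) (hsb : s ≤ b) :
    ∫ v in s..b, ((max a v) ^ 2)⁻¹ = s⁻¹ - b⁻¹ := by
  have h1 : ∀ v ∈ uIcc s b, HasDerivAt (fun v : ℝ => -v⁻¹) (((max a v) ^ 2)⁻¹) v := by
    intro v hv
    rw [uIcc_of_le hsb] at hv
    have hav : a ≤ v := hs.trans hv.1
    rw [max_eq_right hav]
    have := (hasDerivAt_inv (ha.trans_le hav).ne').fun_neg
    rwa [neg_neg] at this
  rw [intervalIntegral.integral_eq_sub_of_hasDerivAt h1]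
  · ring
  · refine Continuous.intervalIntegrable ?_ _ _
    refine Continuous.inv₀ (by fun_prop) fun v => ?_
    have : 0 < max a v := lt_max_of_lt_left ha
    positivity

theorem smoothWeight_nonneg (j : ℕ) (s : ℝ) : 0 ≤ smoothWeight a b j s := by
  rcases le_total s b with h | h
  · exact intervalIntegral.integral_nonneg h fun v _ => rampSlope_nonneg j v
  · rw [smoothWeight_of_ge j h]

theorem radialWeight_eq_of_le {s : ℝ} (hs : s ≤ a) : radialWeight a b s = radialWeight a b a := by
  simp [radialWeight, max_eq_left hs]

theorem radialWeight_of_mem (ha : 0 < a) {s : ℝ} (hs : a ≤ s) (hsb : s ≤ b) :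
    radialWeight a b s = s⁻¹ - b⁻¹ := by
  rw [radialWeight, max_eq_right hs, max_eq_left]
  exact sub_nonneg.2 (inv_anti₀ (ha.trans_le hs) hsb)

theorem radialWeight_of_ge (ha : 0 < a) (hab : a < b) {s : ℝ} (hs : b ≤ s) : radialWeight a b s = 0 := by
  rw [radialWeight, max_eq_right]
  exact sub_nonpos.2 (inv_anti₀ (ha.trans hab) (hs.trans (le_max_right _ _)))

theorem smoothWeight_le (ha : 0 < a) (hab : a < b) (j : ℕ) (s : ℝ) : smoothWeight a b j s ≤ radialWeight a b s := by
  have key : ∀ s, a ≤ s → s ≤ b → smoothWeight a b j s ≤ radialWeight a b s := by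
    intro s hs hsb
    rw [radialWeight_of_mem ha hs hsb, ← integral_inv_sq ha hs hsb]
    refine intervalIntegral.integral_mono_on hsb
      ((continuous_rampSlope ha j).intervalIntegrable _ _)
      (Continuous.intervalIntegrable ?_ _ _) fun v _ => rampSlope_le ha j v
    refine Continuous.inv₀ (by fun_prop) fun v => ?_
    have : 0 < max a v := lt_max_of_lt_left ha
    positivity
  rcases le_total s a with h | h
  · rw [smoothWeight_of_le ha j h, radialWeight_eq_of_le h]
    exact key a le_rfl hab.le
  · rcases le_total s b with h' | h'
    · exact key s h h'
    · rw [smoothWeight_of_ge j h', radialWeight_of_ge ha hab h']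

theorem tendsto_smoothWeight (ha : 0 < a) (hab : a < b) (s : ℝ) :
    Tendsto (fun j => smoothWeight a b j s) atTop (𝓝 (radialWeight a b s)) := by
  have key : ∀ s, a ≤ s → s ≤ b →
      Tendsto (fun j => smoothWeight a b j s) atTop (𝓝 (radialWeight a b s)) := by
    intro s hs hsb
    rw [radialWeight_of_mem ha hs hsb, ← integral_inv_sq ha hs hsb]
    refine intervalIntegral.tendsto_integral_filter_of_dominated_convergence
      (fun v => ((max a v) ^ 2)⁻¹) (Eventually.of_forall fun j =>
        (continuous_rampSlope ha j).aestronglyMeasurable)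
      (Eventually.of_forall fun j => Eventually.of_forall fun v _ => ?_) ?_ ?_
    · rw [Real.norm_of_nonneg (rampSlope_nonneg j v)]
      exact rampSlope_le ha j v
    · refine Continuous.intervalIntegrable ?_ _ _
      refine Continuous.inv₀ (by fun_prop) fun v => ?_
      have : 0 < max a v := lt_max_of_lt_left ha
      positivity
    · have hb : ∀ᵐ v : ℝ, v ≠ b := by simp [ae_iff]
      filter_upwards [hb] with v hvb hv
      rw [uIoc_of_le hsb] at hv
      have := (tendsto_ramp (hs.trans_lt hv.1) (lt_of_le_of_ne hv.2 hvb)).div_const ((max a v) ^ 2)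
      rwa [one_div] at this
  rcases le_total s a with h | h
  · simp_rw [smoothWeight_of_le ha _ h, radialWeight_eq_of_le h]
    exact key a le_rfl hab.le
  · rcases le_total s b with h' | h'
    · exact key s h h'
    · simp_rw [smoothWeight_of_ge _ h', radialWeight_of_ge ha hab h']
      exact tendsto_const_nhds

/-- On `(a, b)` the terms `1/s` cancel and leave `-b⁻¹`. The ramp vanishes at both endpoints, which
is why the limit has a closed interval at `a` and an open one at `b`. -/
theorem tendsto_smoothWeight_sub (ha : 0 < a) (hab : a < b) (s : ℝ) :
    Tendsto (fun j => smoothWeight a b j s - s * rampSlope a b j s) atTop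
      (𝓝 ((Iic a).indicator (fun _ => a⁻¹) s - (Iio b).indicator (fun _ => b⁻¹) s)) := by
  have h1 := tendsto_smoothWeight ha hab s
  by_cases hs : a < s ∧ s < b
  · have h2 := ((tendsto_ramp hs.1 hs.2).div_const ((max a s) ^ 2)).const_mul s
    have h3 := h1.sub h2
    have hs0 : s ≠ 0 := (ha.trans hs.1).ne'
    convert h3 using 1
    congr 1
    rw [radialWeight_of_mem ha hs.1.le hs.2.le, max_eq_right hs.1.le]
    simp [hs.1, hs.2]
    field_simp
    ring
  · have hs' : s ≤ a ∨ b ≤ s := by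
      by_contra h; push Not at h; exact hs h
    simp only [rampSlope, ramp_eq_zero _ hs', zero_div, mul_zero, sub_zero]
    convert h1 using 1
    congr 1
    rcases hs' with h | h
    · rw [radialWeight_eq_of_le h, radialWeight_of_mem ha le_rfl hab.le]
      simp [h, h.trans_lt hab]
    · rw [radialWeight_of_ge ha hab h]
      simp [h, hab.trans_le h]

end Cutoff

/-! ### The monotonicity inequality with curvature and boundary terms -/

section Monotonicity

variable {n : ℕ} {M : Type*} [TopologicalSpace M] [CompactSpace M]
  [ChartedSpace (EuclideanHalfSpace 2) M] [IsManifold (𝓡∂ 2) ∞ M]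
  [MeasurableSpace M] [BorelSpace M]

theorem integrable_of_continuous_area {u : M → E n} (hu : IsBranchedImmersion u) {f : M → ℝ}
    (hf : Continuous f) : Integrable f (areaMeasure u) := by
  have := isFiniteMeasure_areaMeasure hu.1
  exact hf.integrable_of_hasCompactSupport (HasCompactSupport.of_compactSpace f)

variable [T2Space M]

/-- The divergence identity tested with a radial field whose weight decreases. -/
theorem integral_radial_le {u : M → E n} (hu : IsBranchedImmersion u) {H : M → E n}
    (hH : Integrable H (areaMeasure u)) (hdiv : DivergenceIdentity u H) (x₀ : E n)
    {ψ ψ' : ℝ → ℝ} (hψ : ∀ s, HasDerivAt ψ (ψ' s) s) (hcont : Continuous ψ')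
    (hpos : ∀ s, 0 ≤ ψ s) (hneg : ∀ s, ψ' s ≤ 0)
    (hfin : ∫⁻ p : bdry M, ENNReal.ofReal (ψ (‖u p - x₀‖ ^ 2)) *
      ENNReal.ofReal (parallelogramArea (u p - x₀) (unitTangent u p)) ∂(bdryMeasure u) ≠ ⊤) :
    ∫ p, 2 * (ψ (‖u p - x₀‖ ^ 2) + ‖u p - x₀‖ ^ 2 * ψ' (‖u p - x₀‖ ^ 2)) ∂(areaMeasure u) ≤
      ∫ p, ψ (‖u p - x₀‖ ^ 2) * (‖u p - x₀‖ * ‖H p‖) ∂(areaMeasure u) +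
      (∫⁻ p : bdry M, ENNReal.ofReal (ψ (‖u p - x₀‖ ^ 2)) *
        ENNReal.ofReal (parallelogramArea (u p - x₀) (unitTangent u p)) ∂(bdryMeasure u)).toReal := by
  have := isFiniteMeasure_areaMeasure hu.1
  have hcu : Continuous u := hu.1.continuous
  have hψc : Continuous ψ := continuous_iff_continuousAt.2 fun s => (hψ s).continuousAt
  have hψ1 : ContDiff ℝ 1 ψ := by
    rw [contDiff_one_iff_deriv]
    refine ⟨fun s => (hψ s).differentiableAt, ?_⟩
    rwa [show deriv ψ = ψ' from funext fun s => (hψ s).deriv]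
  have hXc : ContDiff ℝ 1 (fun x : E n => ψ (‖x - x₀‖ ^ 2) • (x - x₀)) :=
    (hψ1.comp ((contDiff_id.sub contDiff_const).norm_sq ℝ)).smul (contDiff_id.sub contDiff_const)
  have hid := hdiv _ hXc
  have hae := hu.ae_injective
  have hdiveq : (fun p => tangentialDiv u (fun x => ψ (‖x - x₀‖ ^ 2) • (x - x₀)) p)
      =ᵐ[areaMeasure u] fun p => 2 * ψ (‖u p - x₀‖ ^ 2) + 2 * ψ' (‖u p - x₀‖ ^ 2) *
        inner ℝ (u p - x₀)
          ((LinearMap.range (du u p : E 2 →ₗ[ℝ] E n)).starProjection (u p - x₀)) := by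
    filter_upwards [hae] with p hp
    exact tangentialDiv_radial hp x₀ (hψ _)
  have hint1 : Integrable (fun p => 2 * ψ (‖u p - x₀‖ ^ 2)) (areaMeasure u) :=
    integrable_of_continuous_area hu (by fun_prop)
  have hint2 : Integrable (fun p => 2 * ψ' (‖u p - x₀‖ ^ 2) * inner ℝ (u p - x₀)
          ((LinearMap.range (du u p : E 2 →ₗ[ℝ] E n)).starProjection (u p - x₀)))
      (areaMeasure u) := by
    have hmaj : Integrable (fun p => |2 * ψ' (‖u p - x₀‖ ^ 2)| * ‖u p - x₀‖ ^ 2) (areaMeasure u) :=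
      integrable_of_continuous_area hu (by fun_prop)
    refine hmaj.mono' ?_ (Eventually.of_forall fun p => ?_)
    · refine AEMeasurable.aestronglyMeasurable (AEMeasurable.mul ?_
        (aemeasurable_inner_starProjection hu x₀))
      exact Continuous.aemeasurable (by fun_prop)
    · rw [Real.norm_eq_abs, abs_mul]
      exact mul_le_mul_of_nonneg_left (abs_inner_starProjection_le _ _) (abs_nonneg _)
  have hleft : ∫ p, 2 * (ψ (‖u p - x₀‖ ^ 2) + ‖u p - x₀‖ ^ 2 * ψ' (‖u p - x₀‖ ^ 2))
      ∂(areaMeasure u) ≤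
      ∫ p, tangentialDiv u (fun x => ψ (‖x - x₀‖ ^ 2) • (x - x₀)) p ∂(areaMeasure u) := by
    rw [integral_congr_ae hdiveq]
    refine integral_mono (integrable_of_continuous_area hu (by fun_prop)) (hint1.add hint2) fun p => ?_
    have h1 := (abs_le.1 (abs_inner_starProjection_le
      (LinearMap.range (du u p : E 2 →ₗ[ℝ] E n)) (u p - x₀))).2
    have h2 := mul_le_mul_of_nonpos_left h1 (hneg (‖u p - x₀‖ ^ 2))
    simp only
    linarith
  have hmid : ∫ p, inner ℝ (ψ (‖u p - x₀‖ ^ 2) • (u p - x₀)) (H p) ∂(areaMeasure u) ≤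
      ∫ p, ψ (‖u p - x₀‖ ^ 2) * (‖u p - x₀‖ * ‖H p‖) ∂(areaMeasure u) := by
    obtain ⟨C, hC⟩ := isCompact_univ.exists_bound_of_continuousOn
      (f := fun p : M => ψ (‖u p - x₀‖ ^ 2) * ‖u p - x₀‖) (by fun_prop)
    have hi : Integrable (fun p => ψ (‖u p - x₀‖ ^ 2) * (‖u p - x₀‖ * ‖H p‖)) (areaMeasure u) := by
      have := hH.norm.bdd_mul (c := C) (f := fun p : M => ψ (‖u p - x₀‖ ^ 2) * ‖u p - x₀‖)
        (Continuous.aestronglyMeasurable (by fun_prop))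
        (Eventually.of_forall fun p => hC p trivial)
      simpa only [mul_assoc] using this
    have hb : ∀ p, |inner ℝ (ψ (‖u p - x₀‖ ^ 2) • (u p - x₀)) (H p)| ≤
        ψ (‖u p - x₀‖ ^ 2) * (‖u p - x₀‖ * ‖H p‖) := by
      intro p
      rw [real_inner_smul_left, abs_mul, abs_of_nonneg (hpos _)]
      exact mul_le_mul_of_nonneg_left (abs_real_inner_le_norm _ _) (hpos _)
    refine integral_mono (hi.mono' ?_ (Eventually.of_forall hb)) hi fun p => (le_abs_self _).trans (hb p)
    exact (Continuous.aestronglyMeasurable (by fun_prop)).inner hH.aestronglyMeasurable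
  have hbd : ∫ p : bdry M, inner ℝ (ψ (‖u p - x₀‖ ^ 2) • (u p - x₀)) (conormal u p)
      ∂(bdryMeasure u) ≤ (∫⁻ p : bdry M, ENNReal.ofReal (ψ (‖u p - x₀‖ ^ 2)) *
        ENNReal.ofReal (parallelogramArea (u p - x₀) (unitTangent u p)) ∂(bdryMeasure u)).toReal := by
    by_cases hi : Integrable (fun p : bdry M =>
        inner ℝ (ψ (‖u p - x₀‖ ^ 2) • (u p - x₀)) (conormal u p)) (bdryMeasure u)
    · rw [integral_eq_lintegral_pos_part_sub_lintegral_neg_part hi]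
      refine (sub_le_self _ ENNReal.toReal_nonneg).trans (ENNReal.toReal_mono hfin ?_)
      refine lintegral_mono_ae ?_
      filter_upwards [hu.ae_bdry_injective] with p hp
      rw [← ENNReal.ofReal_mul (hpos _), real_inner_smul_left]
      exact ENNReal.ofReal_le_ofReal (mul_le_mul_of_nonneg_left (conormal_inner_le hp _) (hpos _))
    -- A non-integrable boundary term has integral zero by default, and the bound is nonnegative.
    · rw [integral_undef hi]
      exact ENNReal.toReal_nonneg
  linarith

/-- The comparison of the area ratios at two radii, with the boundary term of the surface. -/
theorem area_ratio_le {u : M → E n} (hu : IsBranchedImmersion u) {H : M → E n}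
    (hH : Integrable H (areaMeasure u)) (hdiv : DivergenceIdentity u H) (x₀ : E n)
    {a b β : ℝ} (ha : 0 < a) (hab : a < b)
    (hβ : ∀ p, ‖u p - x₀‖ ^ 2 < b → ‖u p - x₀‖ ≤ β)
    (hfin : ∫⁻ p : bdry M, ENNReal.ofReal (radialWeight a b (‖u p - x₀‖ ^ 2)) *
      ENNReal.ofReal (parallelogramArea (u p - x₀) (unitTangent u p)) ∂(bdryMeasure u) ≠ ⊤) :
    2 * ((areaMeasure u).real {p | ‖u p - x₀‖ ^ 2 ≤ a} * a⁻¹ -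
        (areaMeasure u).real {p | ‖u p - x₀‖ ^ 2 < b} * b⁻¹) ≤
      (a⁻¹ - b⁻¹) * (β * ∫ p in {p | ‖u p - x₀‖ ^ 2 < b}, ‖H p‖ ∂(areaMeasure u)) +
      (∫⁻ p : bdry M, ENNReal.ofReal (radialWeight a b (‖u p - x₀‖ ^ 2)) *
        ENNReal.ofReal (parallelogramArea (u p - x₀) (unitTangent u p)) ∂(bdryMeasure u)).toReal := by
  have := isFiniteMeasure_areaMeasure hu.1
  have hcu : Continuous u := hu.1.continuous
  have hma : MeasurableSet {p : M | ‖u p - x₀‖ ^ 2 ≤ a} :=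
    (isClosed_le (by fun_prop) continuous_const).measurableSet
  have hmb : MeasurableSet {p : M | ‖u p - x₀‖ ^ 2 < b} :=
    (isOpen_lt (by fun_prop) continuous_const).measurableSet
  have hab' : 0 ≤ a⁻¹ - b⁻¹ := sub_nonneg.2 (inv_anti₀ ha hab.le)
  have hlim : Tendsto (fun j => ∫ p, 2 * (smoothWeight a b j (‖u p - x₀‖ ^ 2) +
        ‖u p - x₀‖ ^ 2 * (-rampSlope a b j (‖u p - x₀‖ ^ 2))) ∂(areaMeasure u)) atTop
      (𝓝 (∫ p, 2 * ((Iic a).indicator (fun _ => a⁻¹) (‖u p - x₀‖ ^ 2) -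
        (Iio b).indicator (fun _ => b⁻¹) (‖u p - x₀‖ ^ 2)) ∂(areaMeasure u))) := by
    refine tendsto_integral_of_dominated_convergence (fun _ => 2 * (a⁻¹ - b⁻¹ + a⁻¹)) ?_
      (integrable_const _) ?_ ?_
    · intro j
      have h1 : Continuous (smoothWeight a b j) :=
        continuous_iff_continuousAt.2 fun s => (hasDerivAt_smoothWeight ha j s).continuousAt
      have h2 := continuous_rampSlope (b := b) ha j
      exact Continuous.aestronglyMeasurable (by fun_prop)
    · refine fun j => Eventually.of_forall fun p => ?_
      have h1 := smoothWeight_nonneg (a := a) (b := b) j (‖u p - x₀‖ ^ 2)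
      have h2 : smoothWeight a b j (‖u p - x₀‖ ^ 2) ≤ a⁻¹ - b⁻¹ := by
        refine (smoothWeight_le ha hab j _).trans (max_le ?_ hab')
        exact sub_le_sub_right (inv_anti₀ ha (le_max_left _ _)) _
      have h3 := mul_rampSlope_le (b := b) ha j (‖u p - x₀‖ ^ 2)
      have h4 := mul_nonneg (sq_nonneg ‖u p - x₀‖)
        (rampSlope_nonneg (a := a) (b := b) j (‖u p - x₀‖ ^ 2))
      rw [Real.norm_eq_abs, abs_le]
      constructor <;> linarith
    · refine Eventually.of_forall fun p => ?_
      have := (tendsto_smoothWeight_sub ha hab (‖u p - x₀‖ ^ 2)).const_mul 2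
      simpa only [mul_neg, ← sub_eq_add_neg] using this
  have hval : ∫ p, 2 * ((Iic a).indicator (fun _ => a⁻¹) (‖u p - x₀‖ ^ 2) -
        (Iio b).indicator (fun _ => b⁻¹) (‖u p - x₀‖ ^ 2)) ∂(areaMeasure u) =
      2 * ((areaMeasure u).real {p | ‖u p - x₀‖ ^ 2 ≤ a} * a⁻¹ -
        (areaMeasure u).real {p | ‖u p - x₀‖ ^ 2 < b} * b⁻¹) := by
    have h1 : (fun p : M => (Iic a).indicator (fun _ => a⁻¹) (‖u p - x₀‖ ^ 2)) =
        {p : M | ‖u p - x₀‖ ^ 2 ≤ a}.indicator fun _ => a⁻¹ := rfl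
    have h2 : (fun p : M => (Iio b).indicator (fun _ => b⁻¹) (‖u p - x₀‖ ^ 2)) =
        {p : M | ‖u p - x₀‖ ^ 2 < b}.indicator fun _ => b⁻¹ := rfl
    rw [integral_const_mul, integral_sub, h1, h2, integral_indicator_const _ hma,
      integral_indicator_const _ hmb, smul_eq_mul, smul_eq_mul]
    · rw [h1]; exact (integrable_const _).indicator hma
    · rw [h2]; exact (integrable_const _).indicator hmb
  rw [hval] at hlim
  refine le_of_tendsto hlim (Eventually.of_forall fun j => ?_)
  have hle : ∫⁻ p : bdry M, ENNReal.ofReal (smoothWeight a b j (‖u p - x₀‖ ^ 2)) *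
      ENNReal.ofReal (parallelogramArea (u p - x₀) (unitTangent u p)) ∂(bdryMeasure u) ≤
      ∫⁻ p : bdry M, ENNReal.ofReal (radialWeight a b (‖u p - x₀‖ ^ 2)) *
      ENNReal.ofReal (parallelogramArea (u p - x₀) (unitTangent u p)) ∂(bdryMeasure u) := by
    refine lintegral_mono fun p => ?_
    gcongr
    exact smoothWeight_le ha hab j _
  refine (integral_radial_le hu hH hdiv x₀ (hasDerivAt_smoothWeight ha j)
    (continuous_rampSlope ha j).neg (smoothWeight_nonneg j)
    (fun s => neg_nonpos.2 (rampSlope_nonneg j s)) (ne_top_of_le_ne_top hfin hle)).trans ?_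
  refine add_le_add ?_ (ENNReal.toReal_mono hfin hle)
  rw [← integral_indicator hmb, ← integral_const_mul, ← integral_const_mul]
  refine integral_mono_of_nonneg (Eventually.of_forall fun p => ?_) ?_
    (Eventually.of_forall fun p => ?_)
  · exact mul_nonneg (smoothWeight_nonneg j _) (mul_nonneg (norm_nonneg _) (norm_nonneg _))
  · exact ((hH.norm.indicator hmb).const_mul _).const_mul _
  · by_cases hp : ‖u p - x₀‖ ^ 2 < b
    · have h1 : {p : M | ‖u p - x₀‖ ^ 2 < b}.indicator (fun p => ‖H p‖) p = ‖H p‖ :=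
        indicator_of_mem (by exact hp) _
      simp only [h1]
      have h2 : smoothWeight a b j (‖u p - x₀‖ ^ 2) ≤ a⁻¹ - b⁻¹ := by
        refine (smoothWeight_le ha hab j _).trans (max_le ?_ hab')
        exact sub_le_sub_right (inv_anti₀ ha (le_max_left _ _)) _
      gcongr
      exact hβ p hp
    · have h1 : {p : M | ‖u p - x₀‖ ^ 2 < b}.indicator (fun p => ‖H p‖) p = 0 :=
        indicator_of_notMem (by exact hp) _
      simp only [h1, smoothWeight_of_ge j (not_lt.1 hp)]
      simp

end Monotonicity

/-! ### Areas of the exterior and interior cones -/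

section Cone

/-- Additivity in the weight needs no measurability of `f`: the weights are moved into the measure.
This is applied with `coneDensity` as `f`. -/
theorem lintegral_add_mul_of_measurable {X : Type*} [MeasurableSpace X] (σ : Measure X)
    {k₁ k₂ : X → ℝ} (h₁ : Measurable k₁) (h₂ : Measurable k₂) (h₁' : ∀ x, 0 ≤ k₁ x)
    (h₂' : ∀ x, 0 ≤ k₂ x) (f : X → ℝ≥0∞) :
    ∫⁻ x, ENNReal.ofReal (k₁ x + k₂ x) * f x ∂σ =
      ∫⁻ x, ENNReal.ofReal (k₁ x) * f x ∂σ + ∫⁻ x, ENNReal.ofReal (k₂ x) * f x ∂σ := by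
  have key : ∀ k : X → ℝ, Measurable k → ∫⁻ x, ENNReal.ofReal (k x) * f x ∂σ =
      ∫⁻ x, f x ∂(σ.withDensity fun x => ENNReal.ofReal (k x)) := fun k hk =>
    (lintegral_withDensity_eq_lintegral_mul_non_measurable σ hk.ennreal_ofReal
      (Eventually.of_forall fun x => ENNReal.ofReal_lt_top) f).symm
  rw [key _ h₁, key _ h₂, key (fun x => k₁ x + k₂ x) (h₁.add h₂), ← lintegral_add_measure,
    ← withDensity_add_left h₁.ennreal_ofReal]
  congr 2
  funext x
  exact ENNReal.ofReal_add (h₁' x) (h₂' x)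

theorem lintegral_Ico_mul {a b c : ℝ} (ha : 0 ≤ a) (hab : a ≤ b) (hc : 0 ≤ c) :
    ∫⁻ t in Ico a b, ENNReal.ofReal (|t| * c) = ENNReal.ofReal (c * (b ^ 2 - a ^ 2) / 2) := by
  have h1 : ∫⁻ t in Ico a b, ENNReal.ofReal (|t| * c) = ∫⁻ t in Ioc a b, ENNReal.ofReal (t * c) := by
    rw [setLIntegral_congr Ico_ae_eq_Ioc]
    refine setLIntegral_congr_fun measurableSet_Ioc fun t ht => ?_
    rw [abs_of_nonneg (ha.trans ht.1.le)]
  rw [h1, ← ofReal_integral_eq_lintegral_ofReal, ← intervalIntegral.integral_of_le hab,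
    intervalIntegral.integral_mul_const, integral_id]
  · congr 1; ring
  · exact (Continuous.integrableOn_Ioc (by fun_prop))
  · filter_upwards [ae_restrict_mem measurableSet_Ioc] with t ht
    exact mul_nonneg (ha.trans ht.1.le) hc

variable {n : ℕ}

theorem parallelogramArea_smul (v w : E n) (t : ℝ) :
    parallelogramArea v (t • w) = |t| * parallelogramArea v w := by
  rw [parallelogramArea, parallelogramArea, norm_smul, inner_smul_right, ← Real.sqrt_sq_eq_abs,
    ← Real.sqrt_mul (sq_nonneg t), Real.norm_eq_abs, mul_pow, sq_abs]
  congr 1; ring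

theorem parallelogramArea_nonneg (v w : E n) : 0 ≤ parallelogramArea v w := Real.sqrt_nonneg _

/-- With `R = ‖x - x₀‖ > 0` the admissible `t` form `[1, r / R)`, and the Jacobian is linear in `t`.
For `R = 0` both sides vanish. -/
theorem lintegral_cone_Ici (x₀ x τ : E n) {r : ℝ} (hr : 0 < r) :
    ∫⁻ t : ℝ in {t : ℝ | t ∈ Ici (1 : ℝ) ∧ x₀ + t • (x - x₀) ∈ Metric.ball x₀ r},
      ENNReal.ofReal (parallelogramArea (x - x₀) (t • τ)) =
    ENNReal.ofReal (r ^ 2 / 2) * (ENNReal.ofReal (max (1 - ‖x - x₀‖ ^ 2 / r ^ 2) 0) *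
      ENNReal.ofReal (parallelogramArea (x - x₀) τ / ‖x - x₀‖ ^ 2)) := by
  simp_rw [parallelogramArea_smul]
  set J := parallelogramArea (x - x₀) τ with hJ
  have hJ0 : 0 ≤ J := parallelogramArea_nonneg _ _
  rcases (norm_nonneg (x - x₀)).eq_or_lt with h0 | hR
  · have : J = 0 := by rw [hJ, parallelogramArea, norm_eq_zero.1 h0.symm]; simp
    simp [this]
  set R := ‖x - x₀‖ with hRdef
  have hset : {t : ℝ | t ∈ Ici (1 : ℝ) ∧ x₀ + t • (x - x₀) ∈ Metric.ball x₀ r} =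
      Ico 1 (r / R) := by
    ext t
    simp only [mem_ofPred_eq, mem_Ici, mem_Ico, Metric.mem_ball, dist_self_add_left, norm_smul,
      Real.norm_eq_abs]
    refine and_congr_right fun ht => ?_
    rw [abs_of_nonneg (zero_le_one.trans ht), lt_div_iff₀ hR]
  rw [hset, ← ENNReal.ofReal_mul (le_max_right _ _), ← ENNReal.ofReal_mul (by positivity)]
  rcases le_total 1 (r / R) with h | h
  · rw [lintegral_Ico_mul zero_le_one h hJ0]
    congr 1
    have hRr : R ≤ r := by rwa [le_div_iff₀ hR, one_mul] at h
    rw [max_eq_left (sub_nonneg.2 (by rw [div_le_one (by positivity)]; gcongr))]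
    field_simp
  · rw [Ico_eq_empty (not_lt.2 h)]
    have hRr : r ≤ R := by rwa [div_le_iff₀ hR, one_mul] at h
    rw [max_eq_right (sub_nonpos.2 (by rw [one_le_div (by positivity)]; gcongr))]
    simp

theorem lintegral_cone_Icc (x₀ x τ : E n) {r : ℝ} (hr : 0 < r) :
    ∫⁻ t : ℝ in {t : ℝ | t ∈ Icc (0 : ℝ) 1 ∧ x₀ + t • (x - x₀) ∈ Metric.ball x₀ r},
      ENNReal.ofReal (parallelogramArea (x - x₀) (t • τ)) =
    ENNReal.ofReal (r ^ 2 / 2) * (ENNReal.ofReal (min 1 (‖x - x₀‖ ^ 2 / r ^ 2)) *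
      ENNReal.ofReal (parallelogramArea (x - x₀) τ / ‖x - x₀‖ ^ 2)) := by
  simp_rw [parallelogramArea_smul]
  set J := parallelogramArea (x - x₀) τ with hJ
  have hJ0 : 0 ≤ J := parallelogramArea_nonneg _ _
  rcases (norm_nonneg (x - x₀)).eq_or_lt with h0 | hR
  · have : J = 0 := by rw [hJ, parallelogramArea, norm_eq_zero.1 h0.symm]; simp
    simp [this]
  set R := ‖x - x₀‖ with hRdef
  have hset : {t : ℝ | t ∈ Icc (0 : ℝ) 1 ∧ x₀ + t • (x - x₀) ∈ Metric.ball x₀ r} =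
      Icc 0 1 ∩ Iio (r / R) := by
    ext t
    simp only [mem_ofPred_eq, mem_inter_iff, mem_Iio, Metric.mem_ball, dist_self_add_left, norm_smul,
      Real.norm_eq_abs]
    refine and_congr_right fun ht => ?_
    rw [abs_of_nonneg ht.1, lt_div_iff₀ hR]
  rw [hset, ← ENNReal.ofReal_mul (by positivity), ← ENNReal.ofReal_mul (by positivity)]
  rcases lt_or_ge 1 (r / R) with h | h
  · have hs : Icc 0 1 ∩ Iio (r / R) = Icc 0 1 :=
      inter_eq_left.2 fun t ht => ht.2.trans_lt h
    rw [hs, ← setLIntegral_congr Ico_ae_eq_Icc, lintegral_Ico_mul le_rfl zero_le_one hJ0]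
    congr 1
    have hRr : R < r := by rwa [lt_div_iff₀ hR, one_mul] at h
    rw [min_eq_right (by rw [div_le_one (by positivity)]; gcongr)]
    field_simp
    ring
  · have hs : Icc 0 1 ∩ Iio (r / R) = Ico 0 (r / R) := by
      ext t
      simp only [mem_inter_iff, mem_Icc, mem_Iio, mem_Ico]
      exact ⟨fun ht => ⟨ht.1.1, ht.2⟩, fun ht => ⟨⟨ht.1, ht.2.le.trans h⟩, ht.2⟩⟩
    rw [hs, lintegral_Ico_mul le_rfl (by positivity) hJ0]
    congr 1
    have hRr : r ≤ R := by rwa [div_le_iff₀ hR, one_mul] at h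
    rw [min_eq_left (by rw [one_le_div (by positivity)]; gcongr)]
    field_simp
    ring

variable {M : Type*} [TopologicalSpace M] [ChartedSpace (EuclideanHalfSpace 2) M]

/-- The density of the cone over `Γ` with respect to the length of `Γ`, up to a constant. -/
def coneDensity (u : M → E n) (x₀ : E n) (p : bdry M) : ℝ≥0∞ :=
  ENNReal.ofReal (parallelogramArea (u p - x₀) (unitTangent u p) / ‖u p - x₀‖ ^ 2)

theorem coneDensity_eq_zero {u : M → E n} {x₀ : E n} {p : bdry M} (hp : ‖u p - x₀‖ = 0) :
    coneDensity u x₀ p = 0 := by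
  simp [coneDensity, hp]

variable [MeasurableSpace M]

/-- `2 / r²` times the area of the exterior cone in the ball of radius `r`. -/
def exteriorConeRatio (u : M → E n) (x₀ : E n) (r : ℝ) : ℝ≥0∞ :=
  ∫⁻ p : bdry M, ENNReal.ofReal (max (1 - ‖u p - x₀‖ ^ 2 / r ^ 2) 0) * coneDensity u x₀ p
    ∂(bdryMeasure u)

theorem coneArea_Ici (u : M → E n) (x₀ : E n) {r : ℝ} (hr : 0 < r) :
    coneArea u x₀ (Ici 1) r = ENNReal.ofReal (r ^ 2 / 2) * exteriorConeRatio u x₀ r := by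
  rw [coneArea, exteriorConeRatio, ← lintegral_const_mul' _ _ ENNReal.ofReal_ne_top]
  exact lintegral_congr fun p => lintegral_cone_Ici x₀ (u p) (unitTangent u p) hr

theorem coneArea_Icc (u : M → E n) (x₀ : E n) {r : ℝ} (hr : 0 < r) :
    coneArea u x₀ (Icc 0 1) r = ENNReal.ofReal (r ^ 2 / 2) *
      ∫⁻ p : bdry M, ENNReal.ofReal (min 1 (‖u p - x₀‖ ^ 2 / r ^ 2)) * coneDensity u x₀ p
        ∂(bdryMeasure u) := by
  rw [coneArea, ← lintegral_const_mul' _ _ ENNReal.ofReal_ne_top]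
  exact lintegral_congr fun p => lintegral_cone_Icc x₀ (u p) (unitTangent u p) hr

theorem exteriorConeRatio_le (u : M → E n) (x₀ : E n) (r : ℝ) :
    exteriorConeRatio u x₀ r ≤ ∫⁻ p : bdry M, coneDensity u x₀ p ∂(bdryMeasure u) := by
  refine lintegral_mono fun p => mul_le_of_le_one_left' ?_
  rw [ENNReal.ofReal_le_one]
  exact max_le (sub_le_self _ (by positivity)) zero_le_one

variable [BorelSpace M]

/-- With `s` the squared distance to `x₀`, the identity `s · radialWeight(s) = (1 - s/b²)⁺ - (1 -
s/a²)⁺` is integrated over `Γ`. It identifies the boundary term of the monotonicity inequality with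
the growth of the exterior cone. -/
theorem exteriorConeRatio_eq_add {u : M → E n} (hu : Continuous u) (x₀ : E n) {a b : ℝ}
    (ha : 0 < a) (hab : a < b) :
    exteriorConeRatio u x₀ b = exteriorConeRatio u x₀ a +
      ∫⁻ p : bdry M, ENNReal.ofReal (radialWeight (a ^ 2) (b ^ 2) (‖u p - x₀‖ ^ 2)) *
        ENNReal.ofReal (parallelogramArea (u p - x₀) (unitTangent u p)) ∂(bdryMeasure u) := by
  have hcw : Continuous fun p : bdry M => u p - x₀ :=
    (hu.comp continuous_subtype_val).sub continuous_const
  have ha2 : 0 < a ^ 2 := by positivity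
  have hab2 : a ^ 2 < b ^ 2 := by gcongr
  have h1 : ∀ p : bdry M, ENNReal.ofReal (radialWeight (a ^ 2) (b ^ 2) (‖u p - x₀‖ ^ 2)) *
        ENNReal.ofReal (parallelogramArea (u p - x₀) (unitTangent u p)) =
      ENNReal.ofReal (‖u p - x₀‖ ^ 2 * radialWeight (a ^ 2) (b ^ 2) (‖u p - x₀‖ ^ 2)) *
        coneDensity u x₀ p := by
    intro p
    have hw : 0 ≤ radialWeight (a ^ 2) (b ^ 2) (‖u p - x₀‖ ^ 2) := le_max_right _ _
    rw [coneDensity, ← ENNReal.ofReal_mul hw, ← ENNReal.ofReal_mul (by positivity)]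
    rcases eq_or_ne (u p - x₀) 0 with h | h
    · simp [h, parallelogramArea]
    · have := norm_ne_zero_iff.2 h
      congr 1
      field_simp
  have hm : Measurable fun s : ℝ => s * radialWeight (a ^ 2) (b ^ 2) s := by
    unfold radialWeight; fun_prop
  rw [lintegral_congr h1, exteriorConeRatio, exteriorConeRatio,
    ← lintegral_add_mul_of_measurable]
  · refine lintegral_congr fun p => ?_
    congr 2
    have hs : 0 ≤ ‖u p - x₀‖ ^ 2 := sq_nonneg _
    generalize ‖u p - x₀‖ ^ 2 = s at hs
    have hb2 : 0 < b ^ 2 := ha2.trans hab2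
    generalize a ^ 2 = A at *
    generalize b ^ 2 = B at *
    rcases le_total s A with h | h
    · rw [radialWeight_eq_of_le h, radialWeight_of_mem ha2 le_rfl hab2.le, max_eq_left, max_eq_left]
      · field_simp; ring
      · rw [sub_nonneg, div_le_one ha2]; exact h
      · rw [sub_nonneg, div_le_one hb2]; exact h.trans hab2.le
    · have hs0 : 0 < s := ha2.trans_le h
      have h0 : max (1 - s / A) 0 = 0 := by
        rw [max_eq_right]; rw [sub_nonpos, one_le_div ha2]; exact h
      rcases le_total s B with h' | h'
      · rw [radialWeight_of_mem ha2 h h', h0, max_eq_left]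
        · field_simp; ring
        · rw [sub_nonneg, div_le_one hb2]; exact h'
      · rw [radialWeight_of_ge ha2 hab2 h', h0, max_eq_right]
        · simp
        · rw [sub_nonpos, one_le_div hb2]; exact h'
  · exact Continuous.measurable (by fun_prop)
  · exact hm.comp (Continuous.measurable (by fun_prop))
  · exact fun p => le_max_right _ _
  · exact fun p => mul_nonneg (sq_nonneg _) (le_max_right _ _)

/-- Only the part of `Γ` inside `B_r(x₀)` contributes. Its mass under the finite measure with
density `coneDensity` shrinks to the mass over `x₀` itself, where the density is zero. -/
theorem exteriorConeRatio_tendsto_zero {u : M → E n} (hu : Continuous u) (x₀ : E n)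
    (hfin : ∫⁻ p : bdry M, coneDensity u x₀ p ∂(bdryMeasure u) ≠ ⊤) :
    Tendsto (exteriorConeRatio u x₀) (𝓝[>] 0) (𝓝 0) := by
  have hc : Continuous fun p : bdry M => ‖u p - x₀‖ := by fun_prop
  set ν := (bdryMeasure u).withDensity (coneDensity u x₀) with hν
  have hm : ∀ r : ℝ, MeasurableSet {p : bdry M | ‖u p - x₀‖ < r} := fun r =>
    (isOpen_lt hc continuous_const).measurableSet
  have hνuniv : ν univ ≠ ⊤ := by rwa [hν, withDensity_apply _ MeasurableSet.univ, setLIntegral_univ]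
  have hle : ∀ r, 0 < r → exteriorConeRatio u x₀ r ≤ ν {p : bdry M | ‖u p - x₀‖ < r} := by
    intro r hr
    rw [hν, withDensity_apply _ (hm r), ← lintegral_indicator (hm r)]
    refine lintegral_mono fun p => ?_
    by_cases h : ‖u p - x₀‖ < r
    · rw [indicator_of_mem (by exact h)]
      refine mul_le_of_le_one_left' ?_
      rw [ENNReal.ofReal_le_one]
      exact max_le (sub_le_self _ (by positivity)) zero_le_one
    · rw [indicator_of_notMem (by exact h), max_eq_right]
      · simp
      · rw [sub_nonpos, one_le_div (by positivity)]
        have := not_lt.1 h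
        gcongr
  have hlim : Tendsto (fun r : ℝ => ν {p : bdry M | ‖u p - x₀‖ < r}) (𝓝[>] 0)
      (𝓝 (ν (⋂ r > (0 : ℝ), {p : bdry M | ‖u p - x₀‖ < r}))) := by
    refine tendsto_measure_biInter_gt (fun r _ => (hm r).nullMeasurableSet)
      (fun i j _ hij p hp => lt_of_lt_of_le hp hij) ⟨1, one_pos, ?_⟩
    exact ne_top_of_le_ne_top hνuniv (measure_mono (subset_univ _))
  have hzero : ν (⋂ r > (0 : ℝ), {p : bdry M | ‖u p - x₀‖ < r}) = 0 := by
    have hset : (⋂ r > (0 : ℝ), {p : bdry M | ‖u p - x₀‖ < r}) = {p : bdry M | ‖u p - x₀‖ = 0} := by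
      ext p
      simp only [mem_iInter, mem_ofPred_eq]
      refine ⟨fun h => le_antisymm (le_of_forall_gt_imp_ge_of_dense fun r hr => (h r hr).le)
        (norm_nonneg _), fun h r hr => h ▸ hr⟩
    rw [hset, hν, withDensity_apply _ (isClosed_eq hc continuous_const).measurableSet]
    refine (setLIntegral_congr_fun (g := fun _ => 0)
      (isClosed_eq hc continuous_const).measurableSet fun p hp => ?_).trans (by simp)
    exact coneDensity_eq_zero hp
  rw [hzero] at hlim
  refine tendsto_of_tendsto_of_tendsto_of_le_of_le' tendsto_const_nhds hlim
    (Eventually.of_forall fun _ => zero_le) ?_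
  filter_upwards [self_mem_nhdsWithin] with r hr using hle r hr

/-- The density of the cone exists, and it bounds the total mass of `coneDensity`. -/
theorem exists_hasDensity_cone {u : M → E n} (hu : Continuous u) (x₀ : E n) :
    ∃ θ : ℝ≥0∞, HasDensity (coneArea u x₀ (Icc 0 1)) θ ∧
      ∫⁻ p : bdry M, coneDensity u x₀ p ∂(bdryMeasure u) ≤ ENNReal.ofReal (2 * Real.pi) * θ := by
  have hc : Continuous fun p : bdry M => ‖u p - x₀‖ := by fun_prop
  set I : ℝ → ℝ≥0∞ := fun r => ∫⁻ p : bdry M,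
    ENNReal.ofReal (min 1 (‖u p - x₀‖ ^ 2 / r ^ 2)) * coneDensity u x₀ p ∂(bdryMeasure u) with hI
  -- The weight `min 1 (R² / r²)` grows as `r` decreases, so the density of the cone exists as a
  -- supremum, possibly infinite.
  have hanti : AntitoneOn I (Ioi 0) := by
    intro r hr s hs hrs
    refine lintegral_mono fun p => ?_
    have hr' : (0 : ℝ) < r := hr
    gcongr
  have hlim : Tendsto I (𝓝[>] 0) (𝓝 (sSup (I '' Ioi 0))) :=
    hanti.tendsto_nhdsGT (OrderTop.bddAbove _)
  have hpi : (0 : ℝ) < 2 * Real.pi := by positivity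
  have hconst : ∀ r : ℝ, 0 < r → coneArea u x₀ (Icc 0 1) r / ENNReal.ofReal (Real.pi * r ^ 2) =
      (ENNReal.ofReal (2 * Real.pi))⁻¹ * I r := by
    intro r hr
    rw [coneArea_Icc u x₀ hr, ← ENNReal.ofReal_inv_of_pos hpi, div_eq_mul_inv,
      ← ENNReal.ofReal_inv_of_pos (by positivity), mul_right_comm,
      ← ENNReal.ofReal_mul (by positivity)]
    congr 2
    field_simp
  refine ⟨(ENNReal.ofReal (2 * Real.pi))⁻¹ * sSup (I '' Ioi 0), ?_, ?_⟩
  · refine (ENNReal.Tendsto.const_mul hlim (Or.inr ?_)).congr' ?_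
    · simp [Real.pi_pos]
    · filter_upwards [self_mem_nhdsWithin] with r hr using (hconst r hr).symm
  · rw [← mul_assoc, ENNReal.mul_inv_cancel (by simp [Real.pi_pos]) ENNReal.ofReal_ne_top, one_mul]
    have hm : ∀ k : ℕ, MeasurableSet {p : bdry M | 1 / ((k : ℝ) + 1) ≤ ‖u p - x₀‖} := fun k =>
      (isClosed_le continuous_const hc).measurableSet
    have hmono : Monotone fun k : ℕ => {p : bdry M | 1 / ((k : ℝ) + 1) ≤ ‖u p - x₀‖} :=
      fun k l hkl p hp => show 1 / ((l : ℝ) + 1) ≤ ‖u p - x₀‖ from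
        (Nat.one_div_le_one_div hkl).trans hp
    have hsupp : ∫⁻ p : bdry M, coneDensity u x₀ p ∂(bdryMeasure u) =
        ∫⁻ p : bdry M in ⋃ k : ℕ, {p : bdry M | 1 / ((k : ℝ) + 1) ≤ ‖u p - x₀‖},
          coneDensity u x₀ p ∂(bdryMeasure u) := by
      rw [← lintegral_indicator (MeasurableSet.iUnion hm)]
      refine lintegral_congr fun p => ?_
      by_cases h : ‖u p - x₀‖ = 0
      · rw [coneDensity_eq_zero h]
        exact (indicator_apply_eq_zero.2 fun _ => coneDensity_eq_zero h).symm
      · obtain ⟨k, hk⟩ := exists_nat_one_div_lt ((norm_nonneg (u p - x₀)).lt_of_ne' h)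
        exact (indicator_of_mem (mem_iUnion.2 ⟨k, hk.le⟩) _).symm
    -- Continuity from below of a measure with density replaces monotone convergence, so
    -- `coneDensity` need not be measurable. At radius `1 / (k + 1)` the weight equals one on the
    -- `k`-th set.
    rw [hsupp, ← withDensity_apply _ (MeasurableSet.iUnion hm), hmono.measure_iUnion]
    refine iSup_le fun k => ?_
    have hk : (0 : ℝ) < 1 / ((k : ℝ) + 1) := Nat.one_div_pos_of_nat
    refine le_trans ?_ (le_sSup (mem_image_of_mem I (show 1 / ((k : ℝ) + 1) ∈ Ioi 0 from hk)))
    rw [withDensity_apply _ (hm k), ← lintegral_indicator (hm k)]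
    refine lintegral_mono fun p => ?_
    by_cases h : 1 / ((k : ℝ) + 1) ≤ ‖u p - x₀‖
    · rw [indicator_of_mem (by exact h), min_eq_left, ENNReal.ofReal_one, one_mul]
      rw [one_le_div (by positivity)]
      gcongr
    · rw [indicator_of_notMem (by exact h)]
      exact zero_le

end Cone

/-! ### A discrete Grönwall inequality -/

section Growth

variable {m : ℝ → ℝ} {α Λ : ℝ}

/-- Bernoulli's inequality for `q⁻¹` with exponent `α ≤ 1` gives `α q^α (q - 1) ≤ q (q^α - 1)`; then
`(q + 1) / 2 ≤ q`. It turns one step of ratio `q` into an increment of `r^α`, with a loss `q²` that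
disappears as `q → 1`. -/
theorem rpow_increment_le (hα : 0 < α) (hα1 : α ≤ 1) {q : ℝ} (hq : 1 < q) :
    α * q ^ α * (q ^ 2 - 1) / 2 ≤ q ^ 2 * (q ^ α - 1) := by
  have hq0 : 0 < q := zero_lt_one.trans hq
  have hx : 0 < q ^ α := Real.rpow_pos_of_pos hq0 α
  have h1 : (q ^ α)⁻¹ ≤ 1 + α * (q⁻¹ - 1) := by
    rw [← Real.inv_rpow hq0.le]
    have h := rpow_one_add_le_one_add_mul_self (s := q⁻¹ - 1) (p := α)
      (by linarith [inv_pos.2 hq0]) hα.le hα1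
    simpa using h
  have h2 : 1 * q ≤ q ^ α * (q + α * (1 - q)) := by
    have h3 := mul_le_mul_of_nonneg_left h1 (mul_pos hx hq0).le
    have h4 : q ^ α * q * (q ^ α)⁻¹ = 1 * q := by field_simp
    have h5 : q ^ α * q * (1 + α * (q⁻¹ - 1)) = q ^ α * (q + α * (1 - q)) := by
      field_simp
    rwa [h4, h5] at h3
  generalize q ^ α = x at *
  have h6 : α * x * (q - 1) ≤ q * (x - 1) := by nlinarith
  have h7 : 0 ≤ α * x * (q - 1) := by
    have : 0 < q - 1 := by linarith
    positivity
  nlinarith [mul_le_mul_of_nonneg_left h6 hq0.le]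

/-- Along the geometric radii `σ q^k` the exponents telescope. No regularity of `m` is needed. -/
theorem le_mul_exp_of_step (hα : 0 < α) (hα1 : α ≤ 1) (hΛ : 0 ≤ Λ) (hm : ∀ r, 0 < r → 0 ≤ m r)
    (hstep : ∀ σ r, 0 < σ → σ < r → m σ ≤ m r +
      (σ ^ 2)⁻¹ * (r ^ 2 - σ ^ 2) / 2 * (α * Λ * r ^ α * m r))
    {σ q : ℝ} (hσ : 0 < σ) (hq : 1 < q) (k : ℕ) :
    m σ ≤ m (σ * q ^ k) * Real.exp (q ^ 2 * Λ * ((σ * q ^ k) ^ α - σ ^ α)) := by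
  have hq0 : 0 < q := zero_lt_one.trans hq
  induction k with
  | zero => simp
  | succ k ih =>
    set ρ := σ * q ^ k with hρ
    have hρ0 : 0 < ρ := by positivity
    have hr : σ * q ^ (k + 1) = ρ * q := by rw [hρ]; ring
    rw [hr]
    have hρr : ρ < ρ * q := lt_mul_of_one_lt_right hρ0 hq
    have h1 := hstep ρ (ρ * q) hρ0 hρr
    have h2 : (ρ * q) ^ α = ρ ^ α * q ^ α := Real.mul_rpow hρ0.le hq0.le
    have hmr := hm (ρ * q) (by positivity)
    have hρα : 0 < ρ ^ α := Real.rpow_pos_of_pos hρ0 α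
    have h3 : (ρ ^ 2)⁻¹ * ((ρ * q) ^ 2 - ρ ^ 2) / 2 * (α * Λ * (ρ * q) ^ α * m (ρ * q)) =
        m (ρ * q) * (Λ * ρ ^ α * (α * q ^ α * (q ^ 2 - 1) / 2)) := by
      rw [h2]
      field_simp
    have h4 : m ρ ≤ m (ρ * q) * Real.exp (q ^ 2 * Λ * ((ρ * q) ^ α - ρ ^ α)) := by
      calc m ρ ≤ m (ρ * q) * (1 + Λ * ρ ^ α * (α * q ^ α * (q ^ 2 - 1) / 2)) := by
            rw [h3] at h1; linarith
        _ ≤ m (ρ * q) * (1 + Λ * ρ ^ α * (q ^ 2 * (q ^ α - 1))) := by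
            gcongr
            exact rpow_increment_le hα hα1 hq
        _ = m (ρ * q) * (q ^ 2 * Λ * ((ρ * q) ^ α - ρ ^ α) + 1) := by rw [h2]; ring
        _ ≤ _ := by
            gcongr
            exact Real.add_one_le_exp _
    calc m σ ≤ _ := ih
      _ ≤ m (ρ * q) * Real.exp (q ^ 2 * Λ * ((ρ * q) ^ α - ρ ^ α)) *
          Real.exp (q ^ 2 * Λ * (ρ ^ α - σ ^ α)) := by gcongr
      _ = _ := by
          rw [mul_assoc, ← Real.exp_add]
          congr 2
          ring

/-- An integrated form of Grönwall's inequality, derived from one-step comparisons. -/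
theorem monotoneOn_exp_mul (hα : 0 < α) (hα1 : α ≤ 1) (hΛ : 0 ≤ Λ) (hm : ∀ r, 0 < r → 0 ≤ m r)
    (hstep : ∀ σ r, 0 < σ → σ < r → m σ ≤ m r +
      (σ ^ 2)⁻¹ * (r ^ 2 - σ ^ 2) / 2 * (α * Λ * r ^ α * m r)) :
    MonotoneOn (fun r => Real.exp (Λ * r ^ α) * m r) (Ioi 0) := by
  intro σ hσ r hr hσr
  have hσ : 0 < σ := hσ
  rcases hσr.eq_or_lt with rfl | hlt
  · exact le_rfl
  have hratio : 1 < r / σ := (one_lt_div hσ).2 hlt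
  -- The ratio is the `(N + 1)`-st root of `r / σ`, so `N + 1` steps end exactly at `r`.
  have hq : ∀ N : ℕ, m σ ≤ m r *
      Real.exp (((r / σ) ^ (1 / ((N : ℝ) + 1))) ^ 2 * Λ * (r ^ α - σ ^ α)) := by
    intro N
    have hN : (0 : ℝ) < 1 / ((N : ℝ) + 1) := Nat.one_div_pos_of_nat
    have h := le_mul_exp_of_step hα hα1 hΛ hm hstep hσ
      (Real.one_lt_rpow hratio hN) (N + 1)
    have hpow : ((r / σ) ^ (1 / ((N : ℝ) + 1))) ^ (N + 1) = r / σ := by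
      rw [← Real.rpow_natCast, ← Real.rpow_mul (zero_lt_one.trans hratio).le]
      push_cast
      rw [one_div_mul_cancel (by positivity), Real.rpow_one]
    rwa [hpow, mul_div_cancel₀ _ hσ.ne'] at h
  have hlim : Tendsto (fun N : ℕ => m r *
      Real.exp (((r / σ) ^ (1 / ((N : ℝ) + 1))) ^ 2 * Λ * (r ^ α - σ ^ α))) atTop
      (𝓝 (m r * Real.exp (Λ * (r ^ α - σ ^ α)))) := by
    have h1 : Tendsto (fun N : ℕ => (r / σ) ^ (1 / ((N : ℝ) + 1))) atTop (𝓝 1) := by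
      have := (tendsto_const_nhds (x := r / σ)).rpow
        (tendsto_one_div_add_atTop_nhds_zero_nat (𝕜 := ℝ)) (Or.inl (zero_lt_one.trans hratio).ne')
      simpa using this
    have h2 := (((h1.pow 2).mul_const Λ).mul_const (r ^ α - σ ^ α)).rexp.const_mul (m r)
    simpa using h2
  have h := ge_of_tendsto' hlim hq
  calc Real.exp (Λ * σ ^ α) * m σ
      ≤ Real.exp (Λ * σ ^ α) * (m r * Real.exp (Λ * (r ^ α - σ ^ α))) := by gcongr
    _ = Real.exp (Λ * r ^ α) * m r := by
        rw [mul_comm (m r), ← mul_assoc, ← Real.exp_add]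
        congr 2
        ring

end Growth

/-! ### The area ratio of the extended surface at small and large radii -/

section Ratio

theorem preimage_ball_eq {n : ℕ} {M : Type*} (u : M → E n) (x₀ : E n) {r : ℝ} (hr : 0 < r) :
    u ⁻¹' Metric.ball x₀ r = {p | ‖u p - x₀‖ ^ 2 < r ^ 2} := by
  ext p
  rw [mem_preimage, mem_ball_iff_norm, mem_ofPred_eq, sq_lt_sq₀ (norm_nonneg _) hr.le]

variable {n : ℕ} {M : Type*} [TopologicalSpace M] [ChartedSpace (EuclideanHalfSpace 2) M]
  [MeasurableSpace M]

/-- `extendedRatio` as a real number. -/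
def massRatio (u : M → E n) (x₀ : E n) (r : ℝ) : ℝ :=
  (areaMeasure u).real (u ⁻¹' Metric.ball x₀ r) / r ^ 2 + (exteriorConeRatio u x₀ r).toReal / 2

theorem massRatio_nonneg (u : M → E n) (x₀ : E n) (r : ℝ) : 0 ≤ massRatio u x₀ r := by
  unfold massRatio; positivity

theorem extendedRatio_eq {u : M → E n} [IsFiniteMeasure (areaMeasure u)] {x₀ : E n}
    (hfin : ∫⁻ p : bdry M, coneDensity u x₀ p ∂(bdryMeasure u) ≠ ⊤) {r : ℝ} (hr : 0 < r) :
    extendedRatio u x₀ r = ENNReal.ofReal (massRatio u x₀ r) := by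
  have h1 : exteriorConeRatio u x₀ r ≠ ⊤ := ne_top_of_le_ne_top hfin (exteriorConeRatio_le u x₀ r)
  have hr2 : 0 < r ^ 2 := by positivity
  rw [extendedRatio, coneArea_Ici u x₀ hr, surfaceArea, massRatio,
    ← ofReal_measureReal, ← ENNReal.ofReal_toReal h1, ← ENNReal.ofReal_mul (by positivity),
    ← ENNReal.ofReal_add (by positivity) (by positivity), ← ENNReal.ofReal_div_of_pos hr2,
    ENNReal.toReal_ofReal (by positivity)]
  congr 1
  field_simp

variable [CompactSpace M] [IsManifold (𝓡∂ 2) ∞ M] [BorelSpace M]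

theorem integral_norm_le_of_propertyP {u H : M → E n} (hu : IsBranchedImmersion u)
    (hH : Integrable H (areaMeasure u)) {x₀ : E n} {α Λ : ℝ} (hP : PropertyP u H x₀ α Λ)
    (hfin : ∫⁻ p : bdry M, coneDensity u x₀ p ∂(bdryMeasure u) ≠ ⊤) {r : ℝ} (hr : 0 < r) :
    ∫ p in u ⁻¹' Metric.ball x₀ r, ‖H p‖ ∂(areaMeasure u) ≤
      α * Λ * r ^ (α + 1) * massRatio u x₀ r := by
  have := isFiniteMeasure_areaMeasure hu.1
  obtain ⟨hα, -, hΛ, h⟩ := hP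
  have h1 := h r hr
  have hc : 0 ≤ α * Λ * r ^ (α + 1) := by positivity
  rw [extendedRatio_eq hfin hr, ← ENNReal.ofReal_mul hc] at h1
  rw [integral_norm_eq_lintegral_enorm hH.aestronglyMeasurable.restrict]
  exact ENNReal.toReal_le_of_le_ofReal (mul_nonneg hc (massRatio_nonneg u x₀ r)) h1

variable [T2Space M]

/-- The bound `β` on the distance is kept apart from `r`: the Grönwall argument takes `β = r`, while
the limit `r → ∞` needs a fixed `β = σ`. -/
theorem massRatio_le_add {u H : M → E n} (hu : IsBranchedImmersion u)
    (hH : Integrable H (areaMeasure u)) (hdiv : DivergenceIdentity u H) {x₀ : E n}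
    (hfin : ∫⁻ p : bdry M, coneDensity u x₀ p ∂(bdryMeasure u) ≠ ⊤) {σ r β : ℝ} (hσ : 0 < σ)
    (hσr : σ < r) (hβ : ∀ p, ‖u p - x₀‖ < r → ‖u p - x₀‖ ≤ β) :
    massRatio u x₀ σ ≤ massRatio u x₀ r + ((σ ^ 2)⁻¹ - (r ^ 2)⁻¹) / 2 *
      (β * ∫ p in u ⁻¹' Metric.ball x₀ r, ‖H p‖ ∂(areaMeasure u)) := by
  have := isFiniteMeasure_areaMeasure hu.1
  have hr : 0 < r := hσ.trans hσr
  have hadd := exteriorConeRatio_eq_add hu.1.continuous x₀ hσ hσr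
  have hr1 : exteriorConeRatio u x₀ r ≠ ⊤ := ne_top_of_le_ne_top hfin (exteriorConeRatio_le u x₀ r)
  have hσ1 : exteriorConeRatio u x₀ σ ≠ ⊤ := ne_top_of_le_ne_top hfin (exteriorConeRatio_le u x₀ σ)
  have hν := ne_top_of_le_ne_top hr1 (hadd ▸ le_add_self)
  have h := area_ratio_le hu hH hdiv x₀ (a := σ ^ 2) (b := r ^ 2) (β := β) (by positivity)
    (by gcongr) (fun p hp => hβ p ((sq_lt_sq₀ (norm_nonneg _) hr.le).1 hp)) hν
  have hreal := congrArg ENNReal.toReal hadd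
  rw [ENNReal.toReal_add hσ1 hν] at hreal
  have hmono : (areaMeasure u).real (u ⁻¹' Metric.ball x₀ σ) ≤
      (areaMeasure u).real {p | ‖u p - x₀‖ ^ 2 ≤ σ ^ 2} := by
    refine measureReal_mono ?_
    rw [preimage_ball_eq u x₀ hσ]
    exact fun p hp => le_of_lt (show ‖u p - x₀‖ ^ 2 < σ ^ 2 from hp)
  rw [← preimage_ball_eq u x₀ hr] at h
  have hmono' := mul_le_mul_of_nonneg_right hmono (inv_nonneg.2 (sq_nonneg σ))
  simp only [massRatio, div_eq_mul_inv] at *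
  linarith

theorem monotoneOn_exp_mul_massRatio {u H : M → E n} (hu : IsBranchedImmersion u)
    (hH : Integrable H (areaMeasure u)) (hdiv : DivergenceIdentity u H) {x₀ : E n} {α Λ : ℝ}
    (hP : PropertyP u H x₀ α Λ)
    (hfin : ∫⁻ p : bdry M, coneDensity u x₀ p ∂(bdryMeasure u) ≠ ⊤) :
    MonotoneOn (fun r => Real.exp (Λ * r ^ α) * massRatio u x₀ r) (Ioi 0) := by
  refine monotoneOn_exp_mul hP.1 hP.2.1 hP.2.2.1 (fun r _ => massRatio_nonneg u x₀ r) ?_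
  intro σ r hσ hσr
  have hr : 0 < r := hσ.trans hσr
  refine (massRatio_le_add hu hH hdiv hfin hσ hσr (β := r) fun p hp => hp.le).trans ?_
  have h1 := integral_norm_le_of_propertyP hu hH hP hfin hr
  have h2 : 0 ≤ ((σ ^ 2)⁻¹ - (r ^ 2)⁻¹) / 2 :=
    div_nonneg (sub_nonneg.2 (inv_anti₀ (by positivity) (by gcongr))) zero_le_two
  have h3 : ((σ ^ 2)⁻¹ - (r ^ 2)⁻¹) / 2 * (r * (α * Λ * r ^ (α + 1) * massRatio u x₀ r)) =
      (σ ^ 2)⁻¹ * (r ^ 2 - σ ^ 2) / 2 * (α * Λ * r ^ α * massRatio u x₀ r) := by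
    rw [Real.rpow_add_one hr.ne']
    field_simp
  rw [← h3]
  gcongr

/-- Outside a ball that contains the surface, the curvature term is controlled by a single radius. -/
theorem massRatio_mul_le {u H : M → E n} (hu : IsBranchedImmersion u)
    (hH : Integrable H (areaMeasure u)) (hdiv : DivergenceIdentity u H) {x₀ : E n} {α Λ : ℝ}
    (hP : PropertyP u H x₀ α Λ)
    (hfin : ∫⁻ p : bdry M, coneDensity u x₀ p ∂(bdryMeasure u) ≠ ⊤) {σ : ℝ} (hσ : 0 < σ)
    (hin : ∀ p, ‖u p - x₀‖ < σ) :
    massRatio u x₀ σ * (1 - α * Λ * σ ^ α / 2) ≤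
      (∫⁻ p : bdry M, coneDensity u x₀ p ∂(bdryMeasure u)).toReal / 2 := by
  have := isFiniteMeasure_areaMeasure hu.1
  set F := (∫⁻ p : bdry M, coneDensity u x₀ p ∂(bdryMeasure u)).toReal
  have huniv : ∀ r, σ ≤ r → u ⁻¹' Metric.ball x₀ r = univ := fun r hr =>
    eq_univ_of_forall fun p => mem_ball_iff_norm.2 ((hin p).trans_le hr)
  have hP1 := integral_norm_le_of_propertyP hu hH hP hfin hσ
  rw [huniv σ le_rfl] at hP1
  have hI : 0 ≤ ∫ p in univ, ‖H p‖ ∂(areaMeasure u) := integral_nonneg fun p => norm_nonneg _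
  have hbound : ∀ᶠ r in atTop, massRatio u x₀ σ * (1 - α * Λ * σ ^ α / 2) ≤
      (areaMeasure u).real univ / r ^ 2 + F / 2 := by
    filter_upwards [eventually_gt_atTop σ] with r hr
    have hr0 : 0 < r := hσ.trans hr
    -- All of `M` lies in `B_σ(x₀)`, so neither `β` nor the integral of `‖H‖` grows with `r`.
    have h1 := massRatio_le_add hu hH hdiv hfin hσ hr (β := σ) fun p _ => (hin p).le
    rw [huniv r hr.le] at h1
    have h2 : massRatio u x₀ r ≤ (areaMeasure u).real univ / r ^ 2 + F / 2 := by
      rw [massRatio, huniv r hr.le]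
      gcongr
      exact ENNReal.toReal_mono hfin (exteriorConeRatio_le u x₀ r)
    have h3 : ((σ ^ 2)⁻¹ - (r ^ 2)⁻¹) / 2 * (σ * ∫ p in univ, ‖H p‖ ∂(areaMeasure u)) ≤
        (σ ^ 2)⁻¹ / 2 * (σ * (α * Λ * σ ^ (α + 1) * massRatio u x₀ σ)) := by
      gcongr
      exact sub_le_self _ (by positivity)
    have h4 : (σ ^ 2)⁻¹ / 2 * (σ * (α * Λ * σ ^ (α + 1) * massRatio u x₀ σ)) =
        massRatio u x₀ σ * (α * Λ * σ ^ α / 2) := by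
      rw [Real.rpow_add_one hσ.ne']
      field_simp
    linarith
  have hlim : Tendsto (fun r : ℝ => (areaMeasure u).real univ / r ^ 2 + F / 2) atTop
      (𝓝 (0 + F / 2)) :=
    (tendsto_const_nhds.div_atTop (tendsto_pow_atTop two_ne_zero)).add_const _
  rw [zero_add] at hlim
  exact ge_of_tendsto hlim hbound

/-- The area ratios of the surface converge when the cone has finite density. -/
theorem exists_tendsto_area_ratio {u H : M → E n} (hu : IsBranchedImmersion u)
    (hH : Integrable H (areaMeasure u)) (hdiv : DivergenceIdentity u H) {x₀ : E n} {α Λ : ℝ}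
    (hP : PropertyP u H x₀ α Λ)
    (hfin : ∫⁻ p : bdry M, coneDensity u x₀ p ∂(bdryMeasure u) ≠ ⊤) :
    ∃ L : ℝ, 0 ≤ L ∧
      Tendsto (fun r => (areaMeasure u).real (u ⁻¹' Metric.ball x₀ r) / r ^ 2) (𝓝[>] 0) (𝓝 L) ∧
      ∀ r, 0 < r → L ≤ Real.exp (Λ * r ^ α) * massRatio u x₀ r := by
  have hmono := monotoneOn_exp_mul_massRatio hu hH hdiv hP hfin
  have hnn : ∀ y ∈ (fun r => Real.exp (Λ * r ^ α) * massRatio u x₀ r) '' Ioi 0, 0 ≤ y := by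
    rintro _ ⟨r, -, rfl⟩
    exact mul_nonneg (Real.exp_pos _).le (massRatio_nonneg u x₀ r)
  have hbdd : BddBelow ((fun r => Real.exp (Λ * r ^ α) * massRatio u x₀ r) '' Ioi 0) := ⟨0, hnn⟩
  refine ⟨_, Real.sInf_nonneg hnn, ?_, fun r hr => csInf_le hbdd (mem_image_of_mem _ hr)⟩
  have h1 := hmono.tendsto_nhdsGT hbdd
  have hexp : Tendsto (fun r : ℝ => Real.exp (-(Λ * r ^ α))) (𝓝[>] 0) (𝓝 1) := by
    have hc : Continuous fun r : ℝ => Real.exp (-(Λ * r ^ α)) := by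
      have := Real.continuous_rpow_const hP.1.le
      fun_prop
    have h := (hc.tendsto 0).mono_left (nhdsWithin_le_nhds (s := Ioi 0))
    simpa [Real.zero_rpow hP.1.ne'] using h
  have hcone : Tendsto (fun r => (exteriorConeRatio u x₀ r).toReal / 2) (𝓝[>] 0) (𝓝 0) := by
    have h := (ENNReal.tendsto_toReal ENNReal.zero_ne_top).comp
      (exteriorConeRatio_tendsto_zero hu.1.continuous x₀ hfin)
    simpa using h.div_const 2
  -- The ratio of `M` alone is the monotone function times `exp(-Λ r^α) → 1`, minus the vanishing
  -- cone part.
  have h2 := (hexp.mul h1).sub hcone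
  rw [one_mul, sub_zero] at h2
  refine h2.congr fun r => ?_
  rw [← mul_assoc, ← Real.exp_add, neg_add_cancel, Real.exp_zero, one_mul, massRatio]
  ring

end Ratio

end BranchedSurface

end

/-! ### Comparison of the densities at the extrinsic diameter -/

open BranchedSurface in
theorem theorem3p1 {n : ℕ} {M : Type*} [TopologicalSpace M] [T2Space M] [CompactSpace M]
    [ChartedSpace (EuclideanHalfSpace 2) M] [IsManifold (𝓡∂ 2) ∞ M]
    [MeasurableSpace M] [BorelSpace M]
    (u : M → E n) (hu : IsBranchedImmersion u) (hΓ : InjOn u (bdry M))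
    (H : M → E n) (hH : HasMeanCurvature u H) (hdiv : DivergenceIdentity u H)
    (x₀ : E n) (α Λ : ℝ) (hP : PropertyP u H x₀ α Λ) :
    ∃ θC : ℝ≥0∞, HasDensity (coneArea u x₀ (Icc 0 1)) θC ∧
      ENNReal.ofReal (Real.exp (-(Λ * extrinsicDiam u ^ α)) *
          (1 - α * Λ * extrinsicDiam u ^ α / 2)) * upperDensity (surfaceArea u x₀) ≤ θC ∧
      (θC ≠ ⊤ → ∃ θM : ℝ≥0∞, θM ≠ ⊤ ∧ HasDensity (surfaceArea u x₀) θM) := by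
  obtain ⟨θC, hθ, hle⟩ := exists_hasDensity_cone hu.1.continuous x₀
  refine ⟨θC, hθ, ?_⟩
  by_cases htop : θC = ⊤
  · exact ⟨htop ▸ le_top, fun h => absurd htop h⟩
  have := isFiniteMeasure_areaMeasure hu.1
  have hπ := Real.pi_pos
  have hrhs : ENNReal.ofReal (2 * Real.pi) * θC ≠ ⊤ := ENNReal.mul_ne_top ENNReal.ofReal_ne_top htop
  have hfin := ne_top_of_le_ne_top hrhs hle
  have hF := ENNReal.toReal_mono hrhs hle
  rw [ENNReal.toReal_mul, ENNReal.toReal_ofReal (by positivity)] at hF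
  obtain ⟨L, hL0, hL, hLle⟩ := exists_tendsto_area_ratio hu hH.1 hdiv hP hfin
  have hdens : HasDensity (surfaceArea u x₀) (ENNReal.ofReal (L / Real.pi)) := by
    refine (ENNReal.tendsto_ofReal (hL.div_const Real.pi)).congr' ?_
    filter_upwards [self_mem_nhdsWithin] with r hr
    have hr : 0 < r := hr
    rw [surfaceArea, ← ofReal_measureReal, ← ENNReal.ofReal_div_of_pos (by positivity)]
    congr 1
    field_simp
  refine ⟨?_, fun _ => ⟨_, ENNReal.ofReal_ne_top, hdens⟩⟩
  have hup : upperDensity (surfaceArea u x₀) = ENNReal.ofReal (L / Real.pi) := hdens.limsup_eq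
  rw [hup]
  by_cases hx : x₀ ∈ range u
  · have hbd : ∀ p, ‖u p - x₀‖ ≤ extrinsicDiam u := fun p => by
      rw [← dist_eq_norm]
      exact Metric.dist_le_diam_of_mem (isCompact_range hu.1.continuous).isBounded
        (mem_range_self p) hx
    have hd0 : 0 ≤ extrinsicDiam u := Metric.diam_nonneg
    -- The radius is strictly larger than `r₀` because the open ball must contain all of `u(M)`;
    -- this also keeps it positive when `r₀ = 0`.
    have hσ : ∀ σ, extrinsicDiam u < σ →
        Real.exp (-(Λ * σ ^ α)) * (1 - α * Λ * σ ^ α / 2) * L ≤ Real.pi * θC.toReal := by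
      intro σ hσ
      have hσ0 : 0 < σ := hd0.trans_lt hσ
      rcases le_total (1 - α * Λ * σ ^ α / 2) 0 with hneg | hpos
      · refine le_trans ?_ (mul_nonneg hπ.le ENNReal.toReal_nonneg)
        exact mul_nonpos_of_nonpos_of_nonneg
          (mul_nonpos_of_nonneg_of_nonpos (Real.exp_pos _).le hneg) hL0
      · have h1 := massRatio_mul_le hu hH.1 hdiv hP hfin hσ0 fun p => (hbd p).trans_lt hσ
        calc Real.exp (-(Λ * σ ^ α)) * (1 - α * Λ * σ ^ α / 2) * L
            ≤ Real.exp (-(Λ * σ ^ α)) * (1 - α * Λ * σ ^ α / 2) *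
              (Real.exp (Λ * σ ^ α) * massRatio u x₀ σ) := by
              gcongr
              exact hLle σ hσ0
          _ = massRatio u x₀ σ * (1 - α * Λ * σ ^ α / 2) := by
              rw [Real.exp_neg]
              field_simp
          _ ≤ Real.pi * θC.toReal := by linarith
    have hlim : Tendsto (fun σ : ℝ => Real.exp (-(Λ * σ ^ α)) * (1 - α * Λ * σ ^ α / 2) * L)
        (𝓝[>] extrinsicDiam u) (𝓝 (Real.exp (-(Λ * extrinsicDiam u ^ α)) *
          (1 - α * Λ * extrinsicDiam u ^ α / 2) * L)) := by
      have hc : Continuous fun σ : ℝ =>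
          Real.exp (-(Λ * σ ^ α)) * (1 - α * Λ * σ ^ α / 2) * L := by
        have := Real.continuous_rpow_const hP.1.le
        fun_prop
      exact (hc.tendsto _).mono_left nhdsWithin_le_nhds
    have hfinal := le_of_tendsto hlim (eventually_nhdsWithin_of_forall hσ)
    -- Only the factor `L / π` must be nonnegative here; a negative constant in front is read as
    -- zero.
    rw [← ENNReal.ofReal_mul' (by positivity)]
    refine ENNReal.ofReal_le_of_le_toReal ?_
    rw [← mul_div_assoc, div_le_iff₀ hπ]
    linarith
  -- Off the compact image, which may be empty, small balls miss the surface.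
  · have hLz : L = 0 := by
      refine tendsto_nhds_unique hL (tendsto_const_nhds.congr' ?_)
      obtain ⟨ε, hε, hball⟩ := Metric.isOpen_iff.1
        (isCompact_range hu.1.continuous).isClosed.isOpen_compl x₀ hx
      filter_upwards [Ioo_mem_nhdsGT hε] with r hr
      have hempty : u ⁻¹' Metric.ball x₀ r = ∅ := by
        refine eq_empty_of_forall_notMem fun p hp => ?_
        exact hball (Metric.ball_subset_ball hr.2.le hp) (mem_range_self p)
      simp [hempty]
    simp [hLz]
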